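/- **Conventions.** All Lie algebras are complex. A *linear deformation* of the bracket $\mu$ of a Lie algebra $\mathfrak g$ is a family $\mu_t=\mu+t\phi$ $(t\in\mathbb C\setminus\{0\})$, where $\phi$ is a Lie bracket on the vector space $\mathfrak g$ and every $\mu_t$ is a Lie bracket. We say that $\mathfrak g$ *linearly deforms to* $\mathfrak r$ if $\mathfrak r$ is isomorphic to $(\mathfrak g,\mu_t)$ for some linear deformation of $\mu$ and some $t\neq 0$. For a dense subspace $\mathcal D$ of a Hilbert space let $\mathcal L^\dagger(\mathcal D)$ be the algebra of operators $X:\mathcal D\to\mathcal D$ whose adjoint also maps $\mathcal D$ into $\mathcal D$; put $X^\dagger=X^*|_{\mathcal D}$ and $[X,Y]=XY-YX$. A pair $A,B\in\mathcal L^\dagger(\mathcal D)$ is *$\mathcal D$-pseudobosonic* if $ABf-BAf=f$ for all $f\in\mathcal D$. A Lie algebra $\mathfrak g$ is *realized by* $(A,B)$ if it is isomorphic to a Lie subalgebra of $\mathcal L^\dagger(\mathcal D)$ that is the linear span of some of the operators $A,B,B^\dagger,A^\dagger,\mathbb I$, with $A$ and $B$ among them if $\dim\mathfrak g\ge 3$.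 The realization is *standard* if moreover the Hilbert space is separable, $\mathcal D=\bigcap_k D(N_0^k)$ is dense for an unbounded self-adjoint operator $N_0$, and there are nonzero $\varphi_0,\Psi_0\in\mathcal D$ with $A\varphi_0=0$, $B^\dagger\Psi_0=0$. A finite-dimensional Lie algebra $\mathfrak m$ is *uniquely realized up to linear deformation* if it has a standard realization by pseudobosonic operators, and $\mathfrak m$ linearly deforms to every nilpotent Lie algebra of dimension $\dim\mathfrak m$ that is realized by some pseudobosonic pair (on any dense subspace of any Hilbert space). For a matrix $\omega\in\mathbb C^{4\times4}$ let $\mathfrak m(\omega)$ be the Lie algebra with basis $v_1,v_2,v_3,v_4,v$, with $v$ central and $[v_i,v_j]=\omega_{ij}v$ for $i<j$. Let $\mathfrak n_{5,2}=\mathfrak h(1)\oplus\mathfrak i\oplus\mathfrak i$ be the sum of the three-dimensional Heisenberg algebra and two one-dimensional abelian ones. On the Schwartz space $\mathcal S(\mathbb R)\subset L^2(\mathbb R)$ let $x$ be the position operator, $p=-i\,\frac{d}{dx}$, $C=\frac1{\sqrt2}(x+ip)$ and $C^\dagger=\frac1{\sqrt2}(x-ip)$. **Theorem.** (1) For every $n\le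 5$ there is a nilpotent Lie algebra $\mathfrak r$ of dimension $n$ that is uniquely realized up to linear deformation, such that every nilpotent Lie algebra $\mathfrak g$ of dimension $n$ linearly deforms to $\mathfrak r$ and $\mathfrak r$ linearly deforms to $\mathfrak g$. Moreover every nilpotent $\mathfrak g$ of dimension $n$ linearly deforms to every nilpotent Lie algebra of dimension $n$ that is realized by pseudobosonic operators. (2) In particular: (i) Shifted harmonic oscillator. For $\alpha\ne\beta$ in $\mathbb C$, the operators $A=C-\alpha\mathbb I$, $B=C^\dagger-\bar\beta\,\mathbb I$ form an $\mathcal S(\mathbb R)$-pseudobosonic pair, and $v_1=A$, $v_2=B$, $v_3=B^\dagger$, $v_4=A^\dagger$, $v=\mathbb I$ satisfy the defining relations of the Lie algebra $\mathfrak a_{sh}=\langle v_1,\dots,v_4,v\mid [v_1,v_2]=[v_3,v_4]=[v_1,v_4]=[v_3,v_2]=v,\ [v_1,v_3]=[v_2,v_4]=[v,v_j]=0\rangle$. The algebra $\mathfrak a_{sh}$ is nilpotent of dimension $5$ and isomorphic to $\mathfrak n_{5,2}$, and every Lie algebra isomorphic to $\mathfrak a_{sh}$ is uniquely realized up to linear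 deformation. (ii) Deformed position and momentum. Let $Q=ax+bp+c\,\mathbb I$ and $P=a'x+b'p+c'\,\mathbb I$ with complex coefficients and $ab'-ba'=1$, so that $[Q,P]=i\mathbb I$. Then $A=\frac1{\sqrt2}(Q+iP)$, $B=\frac1{\sqrt2}(Q-iP)$ form an $\mathcal S(\mathbb R)$-pseudobosonic pair. The operators $A,B,B^\dagger,A^\dagger,\mathbb I$ satisfy the relations of $\mathfrak m(\omega)$, where $\omega_{ij}\mathbb I$ are their commutators, and $\mathfrak m(\omega)$ is nilpotent of dimension $5$, isomorphic to $\mathfrak n_{5,2}$, and uniquely realized up to linear deformation. (iii) Swanson model. For every $\theta\in\mathbb R$ the same three assertions hold for $A=\cos\theta\,C+i\sin\theta\,C^\dagger$ and $B=\cos\theta\,C^\dagger+i\sin\theta\,C$, with $\omega_{12}=\omega_{34}=1$, $\omega_{13}=-i\sin2\theta$, $\omega_{24}=i\sin 2\theta$, $\omega_{14}=\cos2\theta$, $\omega_{23}=-\cos2\theta$. Also every finite-dimensional Lie algebra $\mathfrak s$ with $[\mathfrak s,\mathfrak s]=Z(\mathfrak s)$ of dimension $1$ and $\dim \mathfrak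 s/Z(\mathfrak s)=4$ is uniquely realized up to linear deformation. -/

import Mathlib

namespace Pseudoboson

noncomputable section

/-! ### Lie brackets and linear deformations -/

/-- A bilinear map `μ : V × V → V` that is alternating and satisfies the Jacobi identity. -/
def IsLieBracket {V : Type*} [AddCommGroup V] [Module ℂ V] (μ : V →ₗ[ℂ] V →ₗ[ℂ] V) : Prop :=
  (∀ x, μ x x = 0) ∧ ∀ x y z, μ x (μ y z) + μ y (μ z x) + μ z (μ x y) = 0

/-- The Lie bracket of a complex Lie algebra as a bilinear map. -/
def bracketMap (𝔤 : Type*) [LieRing 𝔤] [LieAlgebra ℂ 𝔤] : 𝔤 →ₗ[ℂ] 𝔤 →ₗ[ℂ] 𝔤 :=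
  LinearMap.mk₂ ℂ (fun x y => ⁅x, y⁆) add_lie smul_lie lie_add lie_smul

/-- `φ` is the direction of a linear deformation `μ_t = μ + t φ` of the bracket `μ` of `𝔤`:
`φ` is a Lie bracket, and so is `μ_t` for every nonzero complex `t`. -/
def IsLinearDeformation (𝔤 : Type*) [LieRing 𝔤] [LieAlgebra ℂ 𝔤]
    (φ : 𝔤 →ₗ[ℂ] 𝔤 →ₗ[ℂ] 𝔤) : Prop :=
  IsLieBracket φ ∧ ∀ t : ℂ, t ≠ 0 → IsLieBracket (bracketMap 𝔤 + t • φ)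

/-- `𝔯` is obtained from `𝔤` by a linear deformation: it is isomorphic to a member `μ_t`, `t ≠ 0`,
of a linear deformation of the bracket `μ` of `𝔤`. -/
def DeformsTo (𝔤 𝔯 : Type*) [LieRing 𝔤] [LieAlgebra ℂ 𝔤] [LieRing 𝔯] [LieAlgebra ℂ 𝔯] : Prop :=
  ∃ φ : 𝔤 →ₗ[ℂ] 𝔤 →ₗ[ℂ] 𝔤, IsLinearDeformation 𝔤 φ ∧
    ∃ t : ℂ, t ≠ 0 ∧ ∃ e : 𝔯 ≃ₗ[ℂ] 𝔤, ∀ x y : 𝔯, e ⁅x, y⁆ = (bracketMap 𝔤 + t • φ) (e x) (e y)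

/-! ### The algebra of operators on a domain -/

section Operators

variable {H : Type*} [NormedAddCommGroup H] [InnerProductSpace ℂ H]

/-- `X` and `Y` are operators on the domain `D`, and `Y` is the restriction to `D` of the adjoint
of `X`. -/
def IsDagger {D : Submodule ℂ H} (X Y : Module.End ℂ D) : Prop :=
  ∀ f g : D, inner ℂ (X f : H) (g : H) = inner ℂ (f : H) (Y g : H)

lemma IsDagger.symm {D : Submodule ℂ H} {X Y : Module.End ℂ D} (h : IsDagger X Y) :
    IsDagger Y X := fun f g => by
  rw [← inner_conj_symm, ← h g f, inner_conj_symm]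

/-- `𝓛†(D)`: the operators that map `D` into itself together with their adjoints.
On a dense `D` such operators are automatically closable. -/
def LDagger (D : Submodule ℂ H) : Subalgebra ℂ (Module.End ℂ D) where
  carrier := {X | ∃ Y, IsDagger X Y}
  mul_mem' := by
    rintro X X' ⟨Y, h⟩ ⟨Y', h'⟩
    refine ⟨Y' * Y, fun f g => ?_⟩
    simp only [Module.End.mul_apply]
    rw [h, h']
  add_mem' := by
    rintro X X' ⟨Y, h⟩ ⟨Y', h'⟩
    refine ⟨Y + Y', fun f g => ?_⟩
    have h1 := h f g
    have h2 := h' f g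
    simp only [LinearMap.add_apply, Submodule.coe_add, inner_add_left, inner_add_right, h1, h2]
  algebraMap_mem' := by
    intro c
    refine ⟨algebraMap ℂ _ (starRingEnd ℂ c), fun f g => ?_⟩
    simp [Module.algebraMap_end_apply, mul_comm (starRingEnd ℂ c)]

/-- The domain of the `k`-th power of an unbounded operator. -/
def powDomain (N : H →ₗ.[ℂ] H) : ℕ → Submodule ℂ H
  | 0 => ⊤
  | k + 1 => ((powDomain N k).comap N.toFun).map N.domain.subtype

/-- `D^∞(N)`, the intersection of the domains of all powers of `N`. -/
def smoothDomain (N : H →ₗ.[ℂ] H) : Submodule ℂ H := ⨅ k, powDomain N k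

/-- The operator `N` is unbounded. -/
def IsUnbounded (N : H →ₗ.[ℂ] H) : Prop := ¬ ∃ c : ℝ, ∀ x : N.domain, ‖N x‖ ≤ c * ‖(x : H)‖

/-- A pair `(A, B)` of `D`-pseudobosonic operators: `A`, `B` and their adjoints map `D` into
itself, and `A B f - B A f = f` for all `f ∈ D`. -/
structure PseudobosonicPair (D : Submodule ℂ H) where
  A : Module.End ℂ D
  B : Module.End ℂ D
  Adag : Module.End ℂ D
  Bdag : Module.End ℂ D
  isDagger_A : IsDagger A Adag
  isDagger_B : IsDagger B Bdag
  ccr : ∀ f : D, A (B f) - B (A f) = f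

namespace PseudobosonicPair

variable {D : Submodule ℂ H} (P : PseudobosonicPair D)

/-- The operators `A`, `B`, `B†`, `A†`, in this order, as elements of `𝓛†(D)`. -/
def op : Fin 4 → LDagger D :=
  ![⟨P.A, P.Adag, P.isDagger_A⟩, ⟨P.B, P.Bdag, P.isDagger_B⟩,
    ⟨P.Bdag, P.B, P.isDagger_B.symm⟩, ⟨P.Adag, P.A, P.isDagger_A.symm⟩]

/-- There are nonzero vacua `φ₀, Ψ₀ ∈ D` with `A φ₀ = 0` and `B† Ψ₀ = 0`. -/
def HasVacua : Prop := (∃ φ₀ : D, φ₀ ≠ 0 ∧ P.A φ₀ = 0) ∧ ∃ Ψ₀ : D, Ψ₀ ≠ 0 ∧ P.Bdag Ψ₀ = 0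

/-- `𝔤` is realized by the pair: it is isomorphic to a Lie subalgebra of `𝓛†(D)` that is spanned
by some of the operators `A`, `B`, `B†`, `A†`, `𝕀`, among them `A` and `B` (unless `dim 𝔤 ≤ 2`,
where this is impossible because `A`, `B` and `[A, B] = 𝕀` are linearly independent). -/
def Realizes (𝔤 : Type*) [LieRing 𝔤] [LieAlgebra ℂ 𝔤] : Prop :=
  ∃ S : Set (LDagger D), S ⊆ insert 1 (Set.range P.op) ∧
    (3 ≤ Module.finrank ℂ 𝔤 → P.op 0 ∈ S ∧ P.op 1 ∈ S) ∧
    ∃ ρ : 𝔤 →ₗ[ℂ] LDagger D, (∀ x y : 𝔤, ρ ⁅x, y⁆ = ρ x * ρ y - ρ y * ρ x) ∧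
      Function.Injective ρ ∧ LinearMap.range ρ = Submodule.span ℂ S

end PseudobosonicPair

end Operators

/-- `𝔤` is realized by pseudobosonic operators on some dense subspace of some Hilbert space. -/
def IsRealized (𝔤 : Type*) [LieRing 𝔤] [LieAlgebra ℂ 𝔤] : Prop :=
  ∃ (H : Type) (_ : NormedAddCommGroup H) (_ : InnerProductSpace ℂ H) (_ : CompleteSpace H)
    (D : Submodule ℂ H) (P : PseudobosonicPair D), Dense (D : Set H) ∧ P.Realizes 𝔤

/-- `𝔤` is realized by pseudobosonic operators that have vacua and act on a dense domain
`D = D^∞(N₀)`, with `N₀` an unbounded self-adjoint operator in a separable Hilbert space. -/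
def IsRealizedStandard (𝔤 : Type*) [LieRing 𝔤] [LieAlgebra ℂ 𝔤] : Prop :=
  ∃ (H : Type) (_ : NormedAddCommGroup H) (_ : InnerProductSpace ℂ H) (_ : CompleteSpace H)
    (_ : TopologicalSpace.SeparableSpace H) (N₀ : H →ₗ.[ℂ] H)
    (P : PseudobosonicPair (smoothDomain N₀)),
    Dense (N₀.domain : Set H) ∧ IsSelfAdjoint N₀ ∧ IsUnbounded N₀ ∧
      Dense (smoothDomain N₀ : Set H) ∧ P.HasVacua ∧ P.Realizes 𝔤

/-! ### Five-dimensional Lie algebras with four generators and scalar commutators -/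

/-- The Lie algebra with basis `v₀, v₁, v₂, v₃, v`, with `v` central and `[vᵢ, vⱼ] = ωᵢⱼ v`
for `i < j` (only these entries of `ω` matter). -/
def CentralExt (_ω : Matrix (Fin 4) (Fin 4) ℂ) : Type := (Fin 4 → ℂ) × ℂ

namespace CentralExt

variable (ω : Matrix (Fin 4) (Fin 4) ℂ)

instance : AddCommGroup (CentralExt ω) := inferInstanceAs (AddCommGroup ((Fin 4 → ℂ) × ℂ))

instance : Module ℂ (CentralExt ω) := inferInstanceAs (Module ℂ ((Fin 4 → ℂ) × ℂ))

/-- The coefficient of `v` in the bracket. -/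
def form (x y : Fin 4 → ℂ) : ℂ :=
  ∑ i, ∑ j, if i < j then ω i j * (x i * y j - x j * y i) else 0

instance : Bracket (CentralExt ω) (CentralExt ω) :=
  ⟨fun x y => ((0, form ω x.1 y.1) : (Fin 4 → ℂ) × ℂ)⟩

lemma form_add_left (x x' y : Fin 4 → ℂ) : form ω (x + x') y = form ω x y + form ω x' y := by
  simp [form, Fin.sum_univ_four]; ring

lemma form_add_right (x y y' : Fin 4 → ℂ) : form ω x (y + y') = form ω x y + form ω x y' := by
  simp [form, Fin.sum_univ_four]; ring

lemma form_smul_right (c : ℂ) (x y : Fin 4 → ℂ) : form ω x (c • y) = c * form ω x y := by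
  simp [form, Fin.sum_univ_four]; ring

lemma form_self (x : Fin 4 → ℂ) : form ω x x = 0 := by
  simp [form, mul_comm]

lemma form_zero_left (y : Fin 4 → ℂ) : form ω 0 y = 0 := by simp [form]

lemma form_zero_right (x : Fin 4 → ℂ) : form ω x 0 = 0 := by simp [form]

instance : LieRing (CentralExt ω) where
  add_lie x y z := Prod.ext (add_zero (0 : Fin 4 → ℂ)).symm (form_add_left ω x.1 y.1 z.1)
  lie_add x y z := Prod.ext (add_zero (0 : Fin 4 → ℂ)).symm (form_add_right ω x.1 y.1 z.1)
  lie_self x := Prod.ext rfl (form_self ω x.1)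
  leibniz_lie x y z := Prod.ext (add_zero (0 : Fin 4 → ℂ)).symm (by
    change form ω x.1 0 = form ω 0 z.1 + form ω y.1 0
    simp [form_zero_left, form_zero_right])

instance : LieAlgebra ℂ (CentralExt ω) where
  lie_smul c x y := Prod.ext (by
    change (0 : Fin 4 → ℂ) = c • 0
    simp) (by
    change form ω x.1 (c • y.1) = _
    exact form_smul_right ω c x.1 y.1)

end CentralExt

/-- Structure constants of `𝔫₅,₂ = 𝔥(1) ⊕ 𝔦 ⊕ 𝔦`: the only nonzero bracket is `[v₀, v₁] = v`. -/
def n52Form : Matrix (Fin 4) (Fin 4) ℂ := !![0, 1, 0, 0; 0, 0, 0, 0; 0, 0, 0, 0; 0, 0, 0, 0]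

/-! ### Position, momentum and ladder operators on the Schwartz space -/

/-- The Hilbert space `L²(ℝ)`. -/
abbrev L2R : Type := MeasureTheory.Lp ℂ 2 (MeasureTheory.volume : MeasureTheory.Measure ℝ)

/-- The inclusion of the Schwartz space into `L²(ℝ)`. -/
def schwartzIncl : SchwartzMap ℝ ℂ →ₗ[ℂ] L2R :=
  (SchwartzMap.toLpCLM ℂ ℂ 2 (MeasureTheory.volume : MeasureTheory.Measure ℝ)).toLinearMap

lemma schwartzIncl_injective : Function.Injective schwartzIncl :=
  SchwartzMap.injective_toLp 2 _

/-- The Schwartz space as a subspace of `L²(ℝ)`. -/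
def schwartzDomain : Submodule ℂ L2R := LinearMap.range schwartzIncl

/-- An operator on Schwartz functions, seen as an operator on the subspace of `L²(ℝ)`. -/
def onL2 (X : Module.End ℂ (SchwartzMap ℝ ℂ)) : Module.End ℂ schwartzDomain :=
  (LinearEquiv.ofInjective schwartzIncl schwartzIncl_injective).conj X

/-- The position operator `(x f)(s) = s f(s)`. -/
def position : Module.End ℂ (SchwartzMap ℝ ℂ) :=
  (SchwartzMap.smulLeftCLM ℂ (fun s : ℝ => (s : ℂ))).toLinearMap

/-- The momentum operator `p f = - i f'`. -/
def momentum : Module.End ℂ (SchwartzMap ℝ ℂ) :=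
  (-Complex.I) • (SchwartzMap.derivCLM ℂ ℂ).toLinearMap

/-- `C = (x + i p) / √2`. -/
def ladderC : Module.End ℂ (SchwartzMap ℝ ℂ) :=
  ((Real.sqrt 2 : ℂ)⁻¹) • (position + Complex.I • momentum)

/-- `C† = (x - i p) / √2`. -/
def ladderCdag : Module.End ℂ (SchwartzMap ℝ ℂ) :=
  ((Real.sqrt 2 : ℂ)⁻¹) • (position - Complex.I • momentum)

/-- `A` and `B` form a pseudobosonic pair on the Schwartz space, dense in `L²(ℝ)`, and
`v₀ = A`, `v₁ = B`, `v₂ = B†`, `v₃ = A†`, `v = 𝕀` satisfy the defining relations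
`[vᵢ, vⱼ] = ωᵢⱼ v` (`i < j`) of `CentralExt ω`, the Lie algebra of the model. -/
def IsModel (A B : Module.End ℂ (SchwartzMap ℝ ℂ)) (ω : Matrix (Fin 4) (Fin 4) ℂ) : Prop :=
  Dense (schwartzDomain : Set L2R) ∧
    ∃ P : PseudobosonicPair schwartzDomain, P.A = onL2 A ∧ P.B = onL2 B ∧
      ∀ i j : Fin 4, i < j →
        P.op i * P.op j - P.op j * P.op i = ω i j • (1 : LDagger schwartzDomain)

/-- Structure constants for the shifted harmonic oscillator:
`[v₀,v₁] = [v₂,v₃] = [v₀,v₃] = [v₂,v₁] = v`, `[v₀,v₂] = [v₁,v₃] = 0`. -/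
def shiftedForm : Matrix (Fin 4) (Fin 4) ℂ :=
  !![0, 1, 0, 1; 0, 0, -1, 0; 0, 0, 0, 1; 0, 0, 0, 0]

/-- The operator `a x + b p + c`. -/
def affineOp (a b c : ℂ) : Module.End ℂ (SchwartzMap ℝ ℂ) :=
  a • position + b • momentum + c • 1

/-- Structure constants for the pair `A = (Q + i P)/√2`, `B = (Q - i P)/√2` with deformed position
and momentum `Q = a x + b p + c`, `P = a' x + b' p + c'`. If `uᵢ x + wᵢ p + const` are the operators
`A`, `B`, `B†`, `A†`, their commutators are `i (uᵢ wⱼ - wᵢ uⱼ)`. -/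
def deformedForm (a b a' b' : ℂ) : Matrix (Fin 4) (Fin 4) ℂ :=
  let conj := starRingEnd ℂ
  let uA : ℂ := (a + Complex.I * a') / Real.sqrt 2
  let wA : ℂ := (b + Complex.I * b') / Real.sqrt 2
  let uB : ℂ := (a - Complex.I * a') / Real.sqrt 2
  let wB : ℂ := (b - Complex.I * b') / Real.sqrt 2
  let u : Fin 4 → ℂ := ![uA, uB, conj uB, conj uA]
  let w : Fin 4 → ℂ := ![wA, wB, conj wB, conj wA]
  Matrix.of fun i j => Complex.I * (u i * w j - w i * u j)

/-- Structure constants for the Swanson model. -/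
def swansonForm (θ : ℝ) : Matrix (Fin 4) (Fin 4) ℂ :=
  let s : ℂ := Real.sin (2 * θ)
  let c : ℂ := Real.cos (2 * θ)
  !![0, 1, -Complex.I * s, c; 0, 0, -c, Complex.I * s; 0, 0, 0, 1; 0, 0, 0, 0]

/-- `𝔪` has a realization by pseudobosonic operators, and this is unique up to linear
deformations: every nilpotent Lie algebra of the same dimension that is realized by pseudobosonic
operators is obtained from `𝔪` by a linear deformation. -/
def IsUniquelyRealized (𝔪 : Type*) [LieRing 𝔪] [LieAlgebra ℂ 𝔪] : Prop :=
  IsRealizedStandard 𝔪 ∧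
    ∀ (𝔯 : Type) [LieRing 𝔯] [LieAlgebra ℂ 𝔯] [FiniteDimensional ℂ 𝔯] [LieRing.IsNilpotent 𝔯],
      Module.finrank ℂ 𝔯 = Module.finrank ℂ 𝔪 → IsRealized 𝔯 → DeformsTo 𝔪 𝔯

/-- `𝔪` is a nilpotent Lie algebra of dimension five isomorphic to `𝔫₅,₂ = 𝔥(1) ⊕ 𝔦 ⊕ 𝔦`. -/
def IsNilpotentN52 (𝔪 : Type*) [LieRing 𝔪] [LieAlgebra ℂ 𝔪] : Prop :=
  LieRing.IsNilpotent 𝔪 ∧ Module.finrank ℂ 𝔪 = 5 ∧ Nonempty (𝔪 ≃ₗ⁅ℂ⁆ CentralExt n52Form)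

end

end Pseudoboson

open Pseudoboson

namespace Pseudoboson

noncomputable section

/-! The mechanism is one linear family of brackets. On ℂⁿ with n ≤ 5, the brackets [e₀,e₁] = a e₂,
[e₀,e₂] = b e₃, [e₀,e₃] = c e₄, [e₁,e₂] = d e₄ satisfy the Jacobi identity for all a, b, c, d
(`isLieBracket_flagBracket`) and depend linearly on these parameters. If 𝔤 and 𝔯 both have this
form, the line through their brackets consists of Lie brackets and its direction is a Lie bracket
too, so 𝔤 linearly deforms to 𝔯 (`HasFlagForm.deformsTo`).

Every nilpotent Lie algebra of dimension at most five has this form (`exists_flagForm`). It is a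
central extension, by a line, of a nilpotent algebra of dimension one less; adapted bases normalize
the new coefficients, and the Jacobi identity kills those that do not fit. Hence any two nilpotent
algebras of the same dimension n ≤ 5 deform to each other, and unique realizability reduces to the
existence of a standard realization.

The models on 𝒮(ℝ) do not provide one in dimension five: A, B, B†, A†, 𝕀 all lie in the span of x,
p, 𝕀. A second degree of freedom is added on ℓ²(ℕ × ℕ), with N₀ the multiplication by (n+1)(m+1),
whose smooth domain consists of the rapidly decaying families. The pair A = L₁, B = R₁ + Y, with Y
bounded and diagonal in the second factor, has B† − A = Y† and A† − B = −Y, which commute with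
everything in the span; this realizes the Heisenberg algebra plus central summands
(`isRealizedStandard_of_heisenberg`). The pair A = L₁, B = R₁ + R₂ has B† − A = L₂ and B − A† = R₂;
this realizes the five-dimensional Heisenberg algebra (`isRealizedStandard_of_twoMode`).

In the models the commutator form is i u∧w, where u and w collect the coefficients of x and p. It
has rank two, so 𝔪(ω) ≅ 𝔫₅,₂ (`isNilpotentN52_of_rank_two`). If [𝔰,𝔰] = Z(𝔰) is a line of
codimension four, then a = b = 0 and c, d ≠ 0, which is the two-mode case
(`isUniquelyRealized_of_center`). -/

/-! ### A linear family of nilpotent brackets -/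

/-- The `i`-th coordinate on `ℂⁿ`, zero if `i ≥ n`. -/
def coord (n i : ℕ) : (Fin n → ℂ) →ₗ[ℂ] ℂ :=
  if h : i < n then LinearMap.proj ⟨i, h⟩ else 0

/-- The `2 × 2` minor of the coordinates `i` and `j`. -/
def minor (n i j : ℕ) (x y : Fin n → ℂ) : ℂ :=
  coord n i x * coord n j y - coord n j x * coord n i y

/-- The components of `[e₀,e₁] = a e₂`, `[e₀,e₂] = b e₃`, `[e₀,e₃] = c e₄`, `[e₁,e₂] = d e₄`. -/
def flagFun (n : ℕ) (a b c d : ℂ) (x y : Fin n → ℂ) (k : Fin n) : ℂ :=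
  if (k : ℕ) = 2 then a * minor n 0 1 x y
  else if (k : ℕ) = 3 then b * minor n 0 2 x y
  else if (k : ℕ) = 4 then c * minor n 0 3 x y + d * minor n 1 2 x y
  else 0

/-- The bracket `[e₀,e₁] = a e₂`, `[e₀,e₂] = b e₃`, `[e₀,e₃] = c e₄`, `[e₁,e₂] = d e₄` on `ℂⁿ`,
`n ≤ 5`, where basis vectors that do not exist are read as zero. -/
def flagBracket (n : ℕ) (a b c d : ℂ) : (Fin n → ℂ) →ₗ[ℂ] (Fin n → ℂ) →ₗ[ℂ] (Fin n → ℂ) :=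
  LinearMap.mk₂ ℂ (flagFun n a b c d)
    (fun x x' y => by
      ext k; simp only [flagFun, minor, map_add, Pi.add_apply]; split_ifs <;> ring)
    (fun t x y => by
      ext k; simp only [flagFun, minor, map_smul, Pi.smul_apply, smul_eq_mul]
      split_ifs <;> ring)
    (fun x y y' => by
      ext k; simp only [flagFun, minor, map_add, Pi.add_apply]; split_ifs <;> ring)
    (fun t x y => by
      ext k; simp only [flagFun, minor, map_smul, Pi.smul_apply, smul_eq_mul]
      split_ifs <;> ring)

lemma flagBracket_apply (n : ℕ) (a b c d : ℂ) (x y : Fin n → ℂ) (k : Fin n) :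
    flagBracket n a b c d x y k = flagFun n a b c d x y k := rfl

lemma coord_eq {n i : ℕ} (h : i < n) (x : Fin n → ℂ) : coord n i x = x ⟨i, h⟩ := by
  simp [coord, h]

lemma coord_flagBracket (n : ℕ) (a b c d : ℂ) (x y : Fin n → ℂ) (i : ℕ) (hi : i < 4) (h : i < n) :
    coord n i (flagBracket n a b c d x y) =
      if i = 2 then a * minor n 0 1 x y else if i = 3 then b * minor n 0 2 x y else 0 := by
  rw [coord_eq h, flagBracket_apply, flagFun]
  have : i ≠ 4 := by omega
  simp [this]

/-- A bracket has no components along e₀ and e₁. So [x,[y,z]] has only the components ab x₀M₀₁ along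
e₃ and bc x₀M₀₂ + ad x₁M₀₁ along e₄, with M the minors of y, z. Each cyclic sum is a 3 × 3
determinant with a repeated row, so no condition on the parameters arises. -/
lemma isLieBracket_flagBracket (n : ℕ) (a b c d : ℂ) : IsLieBracket (flagBracket n a b c d) := by
  refine ⟨fun x => ?_, fun x y z => ?_⟩
  · ext k
    simp only [flagBracket_apply, flagFun, minor, Pi.zero_apply]
    split_ifs <;> ring
  · ext ⟨k, hk⟩
    simp only [flagBracket_apply, flagFun, minor, Pi.zero_apply, Pi.add_apply]
    split_ifs with h2 h3 h4
    · subst h2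
      rw [coord_flagBracket _ _ _ _ _ _ _ 0 (by omega) (by omega),
        coord_flagBracket _ _ _ _ _ _ _ 0 (by omega) (by omega),
        coord_flagBracket _ _ _ _ _ _ _ 0 (by omega) (by omega),
        coord_flagBracket _ _ _ _ _ _ _ 1 (by omega) (by omega),
        coord_flagBracket _ _ _ _ _ _ _ 1 (by omega) (by omega),
        coord_flagBracket _ _ _ _ _ _ _ 1 (by omega) (by omega)]
      simp
    · subst h3
      rw [coord_flagBracket _ _ _ _ _ _ _ 0 (by omega) (by omega),
        coord_flagBracket _ _ _ _ _ _ _ 0 (by omega) (by omega),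
        coord_flagBracket _ _ _ _ _ _ _ 0 (by omega) (by omega),
        coord_flagBracket _ _ _ _ _ _ _ 2 (by omega) (by omega),
        coord_flagBracket _ _ _ _ _ _ _ 2 (by omega) (by omega),
        coord_flagBracket _ _ _ _ _ _ _ 2 (by omega) (by omega)]
      simp [minor]
      ring
    · subst h4
      rw [coord_flagBracket _ _ _ _ _ _ _ 0 (by omega) (by omega),
        coord_flagBracket _ _ _ _ _ _ _ 0 (by omega) (by omega),
        coord_flagBracket _ _ _ _ _ _ _ 0 (by omega) (by omega),
        coord_flagBracket _ _ _ _ _ _ _ 1 (by omega) (by omega),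
        coord_flagBracket _ _ _ _ _ _ _ 1 (by omega) (by omega),
        coord_flagBracket _ _ _ _ _ _ _ 1 (by omega) (by omega),
        coord_flagBracket _ _ _ _ _ _ _ 2 (by omega) (by omega),
        coord_flagBracket _ _ _ _ _ _ _ 2 (by omega) (by omega),
        coord_flagBracket _ _ _ _ _ _ _ 2 (by omega) (by omega),
        coord_flagBracket _ _ _ _ _ _ _ 3 (by omega) (by omega),
        coord_flagBracket _ _ _ _ _ _ _ 3 (by omega) (by omega),
        coord_flagBracket _ _ _ _ _ _ _ 3 (by omega) (by omega)]
      simp [minor]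
      ring
    · simp

lemma flagBracket_add_smul_sub (n : ℕ) (a b c d a' b' c' d' t : ℂ) :
    flagBracket n a b c d + t • (flagBracket n a' b' c' d' - flagBracket n a b c d) =
      flagBracket n (a + t * (a' - a)) (b + t * (b' - b)) (c + t * (c' - c))
        (d + t * (d' - d)) := by
  refine LinearMap.ext fun x => LinearMap.ext fun y => ?_
  ext k
  simp only [LinearMap.add_apply, LinearMap.smul_apply, LinearMap.sub_apply, Pi.add_apply,
    Pi.smul_apply, Pi.sub_apply, flagBracket_apply, flagFun, smul_eq_mul]
  split_ifs <;> ring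

lemma flagBracket_sub (n : ℕ) (a b c d a' b' c' d' : ℂ) :
    flagBracket n a' b' c' d' - flagBracket n a b c d =
      flagBracket n (a' - a) (b' - b) (c' - c) (d' - d) := by
  refine LinearMap.ext fun x => LinearMap.ext fun y => ?_
  ext k
  simp only [LinearMap.sub_apply, Pi.sub_apply, flagBracket_apply, flagFun]
  split_ifs <;> ring

/-- `𝔤` is isomorphic to `ℂⁿ` with a bracket of the family `flagBracket`. -/
def HasFlagForm (n : ℕ) (𝔤 : Type*) [LieRing 𝔤] [LieAlgebra ℂ 𝔤] (a b c d : ℂ) : Prop :=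
  ∃ e : 𝔤 ≃ₗ[ℂ] (Fin n → ℂ), ∀ x y : 𝔤, e ⁅x, y⁆ = flagBracket n a b c d (e x) (e y)

/-- Transport of a bilinear map along a linear equivalence. -/
def pullBracket {V W : Type*} [AddCommGroup V] [Module ℂ V] [AddCommGroup W] [Module ℂ W]
    (e : V ≃ₗ[ℂ] W) (μ : W →ₗ[ℂ] W →ₗ[ℂ] W) : V →ₗ[ℂ] V →ₗ[ℂ] V :=
  (μ.compl₁₂ e.toLinearMap e.toLinearMap).compr₂ e.symm.toLinearMap

section pull
variable {V W : Type*} [AddCommGroup V] [Module ℂ V] [AddCommGroup W] [Module ℂ W]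

lemma pullBracket_apply (e : V ≃ₗ[ℂ] W) (μ : W →ₗ[ℂ] W →ₗ[ℂ] W) (x y : V) :
    pullBracket e μ x y = e.symm (μ (e x) (e y)) := rfl

lemma IsLieBracket.pullBracket (e : V ≃ₗ[ℂ] W) {μ : W →ₗ[ℂ] W →ₗ[ℂ] W} (h : IsLieBracket μ) :
    IsLieBracket (pullBracket e μ) := by
  refine ⟨fun x => by simp [pullBracket_apply, h.1], fun x y z => ?_⟩
  simp only [pullBracket_apply, LinearEquiv.apply_symm_apply, ← map_add, h.2, map_zero]

end pull

/-- The direction is the difference of the two brackets, transported to 𝔤. By linearity in the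
parameters it belongs to the family, and so does every μ + tφ; at t = 1 the target bracket is
reached. -/
lemma HasFlagForm.deformsTo {n : ℕ} {𝔤 𝔯 : Type*} [LieRing 𝔤] [LieAlgebra ℂ 𝔤]
    [LieRing 𝔯] [LieAlgebra ℂ 𝔯] {a b c d a' b' c' d' : ℂ} (hg : HasFlagForm n 𝔤 a b c d)
    (hr : HasFlagForm n 𝔯 a' b' c' d') : DeformsTo 𝔤 𝔯 := by
  obtain ⟨e, he⟩ := hg
  obtain ⟨e', he'⟩ := hr
  have hμ : bracketMap 𝔤 = pullBracket e (flagBracket n a b c d) := by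
    refine LinearMap.ext fun x => LinearMap.ext fun y => ?_
    rw [pullBracket_apply, ← he, LinearEquiv.symm_apply_apply]
    rfl
  have hsum : ∀ t : ℂ, bracketMap 𝔤 +
      t • pullBracket e (flagBracket n a' b' c' d' - flagBracket n a b c d) =
      pullBracket e (flagBracket n a b c d +
        t • (flagBracket n a' b' c' d' - flagBracket n a b c d)) := by
    intro t
    rw [hμ]
    refine LinearMap.ext fun x => LinearMap.ext fun y => ?_
    simp [pullBracket_apply]
  refine ⟨pullBracket e (flagBracket n a' b' c' d' - flagBracket n a b c d), ⟨?_, fun t _ => ?_⟩,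
    1, one_ne_zero, e'.trans e.symm, fun x y => ?_⟩
  · rw [flagBracket_sub]
    exact (isLieBracket_flagBracket _ _ _ _ _).pullBracket e
  · rw [hsum, flagBracket_add_smul_sub]
    exact (isLieBracket_flagBracket _ _ _ _ _).pullBracket e
  · rw [hsum, pullBracket_apply]
    simp [he']

/-! ### Normal forms of nilpotent Lie algebras of dimension at most five -/

universe u

/-- The induction step of the normal forms: a nonzero nilpotent algebra has a nonzero central vector
z, and a bracket relation in the quotient by ℂz lifts up to a multiple of z. -/
lemma exists_central_quotient {𝔤 : Type u} [LieRing 𝔤] [LieAlgebra ℂ 𝔤] [FiniteDimensional ℂ 𝔤]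
    [LieRing.IsNilpotent 𝔤] {n : ℕ} (hn : Module.finrank ℂ 𝔤 = n + 1) :
    ∃ (z : 𝔤) (𝔥 : Type u) (_ : LieRing 𝔥) (_ : LieAlgebra ℂ 𝔥) (π : 𝔤 →ₗ⁅ℂ⁆ 𝔥),
      FiniteDimensional ℂ 𝔥 ∧ LieRing.IsNilpotent 𝔥 ∧ Module.finrank ℂ 𝔥 = n ∧
      Function.Surjective π ∧ (∀ x : 𝔤, ⁅x, z⁆ = 0) ∧ ∀ x, π x = 0 → ∃ t : ℂ, x = t • z := by
  have : Nontrivial 𝔤 := Module.nontrivial_of_finrank_pos (R := ℂ) (by omega)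
  have : Nontrivial (LieAlgebra.center ℂ 𝔤) := LieAlgebra.non_trivial_center_of_isNilpotent
  obtain ⟨⟨z, hz⟩, hz0⟩ := exists_ne (0 : LieAlgebra.center ℂ 𝔤)
  have hz0 : z ≠ 0 := fun h => hz0 (Subtype.ext h)
  have hc : ∀ x : 𝔤, ⁅x, z⁆ = 0 := by
    intro x
    exact (LieModule.mem_maxTrivSubmodule ℂ 𝔤 𝔤 z).1 hz x
  let I : LieIdeal ℂ 𝔤 :=
    { Submodule.span ℂ {z} with
      lie_mem := by
        intro x m hm
        obtain ⟨t, rfl⟩ := Submodule.mem_span_singleton.1 hm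
        rw [lie_smul, hc, smul_zero]
        exact Submodule.zero_mem _ }
  have hI : (I : Submodule ℂ 𝔤) = Submodule.span ℂ {z} := rfl
  have hs : Function.Surjective (LieSubmodule.Quotient.mk' I) :=
    LieSubmodule.Quotient.surjective_mk' I
  let π : 𝔤 →ₗ⁅ℂ⁆ 𝔤 ⧸ I :=
    { (LieSubmodule.Quotient.mk' I : 𝔤 →ₗ[ℂ] 𝔤 ⧸ I) with
      map_lie' := by intro x y; rfl }
  have hπ : Function.Surjective π := hs
  refine ⟨z, 𝔤 ⧸ I, inferInstance, inferInstance, π, ?_, hπ.lieAlgebra_isNilpotent, ?_, hπ, hc,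
    fun x hx => ?_⟩
  · exact inferInstanceAs (FiniteDimensional ℂ (𝔤 ⧸ (I : Submodule ℂ 𝔤)))
  · have h1 := Submodule.finrank_quotient_add_finrank (I : Submodule ℂ 𝔤)
    have h2 : Module.finrank ℂ (I : Submodule ℂ 𝔤) = 1 := by
      rw [hI]; exact finrank_span_singleton hz0
    have h3 : Module.finrank ℂ (𝔤 ⧸ I) = Module.finrank ℂ (𝔤 ⧸ (I : Submodule ℂ 𝔤)) := rfl
    omega
  · have : x ∈ (I : Submodule ℂ 𝔤) := (LieSubmodule.Quotient.mk_eq_zero (N := I)).1 hx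
    rw [hI, Submodule.mem_span_singleton] at this
    obtain ⟨t, rfl⟩ := this
    exact ⟨t, rfl⟩

/-! ### Spanning families and normal forms up to dimension four. -/

section Cases

variable {𝔤 : Type u} [LieRing 𝔤] [LieAlgebra ℂ 𝔤]

/-- A linear equivalence with `ℂⁿ` from a spanning family of the right size. -/
lemma exists_equiv_of_spanning [FiniteDimensional ℂ 𝔤] {n : ℕ} (hn : Module.finrank ℂ 𝔤 = n)
    (v : Fin n → 𝔤) (hv : ∀ x, ∃ t : Fin n → ℂ, x = ∑ i, t i • v i) :
    ∃ e : 𝔤 ≃ₗ[ℂ] (Fin n → ℂ), ∀ t : Fin n → ℂ, e.symm t = ∑ i, t i • v i := by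
  have hs : ⊤ ≤ Submodule.span ℂ (Set.range v) := by
    intro x _
    obtain ⟨t, rfl⟩ := hv x
    exact Submodule.sum_mem _ fun i _ =>
      Submodule.smul_mem _ _ (Submodule.subset_span (Set.mem_range_self i))
  let B := basisOfTopLeSpanOfCardEqFinrank v hs (by simp [hn])
  refine ⟨B.equivFun, fun t => ?_⟩
  rw [Module.Basis.equivFun_symm_apply]
  simp [B]

/-- A spanning family of n vectors in dimension n is a basis, so linear independence never has to be
checked in the case analysis. -/
lemma hasFlagForm_of_spanning [FiniteDimensional ℂ 𝔤] {n : ℕ} (hn : Module.finrank ℂ 𝔤 = n)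
    (v : Fin n → 𝔤) (hv : ∀ x, ∃ t : Fin n → ℂ, x = ∑ i, t i • v i) {a b c d : ℂ}
    (h : ∀ s t : Fin n → ℂ, ⁅∑ i, s i • v i, ∑ i, t i • v i⁆ =
      ∑ i, flagFun n a b c d s t i • v i) : HasFlagForm n 𝔤 a b c d := by
  obtain ⟨e, he⟩ := exists_equiv_of_spanning hn v hv
  refine ⟨e, fun x y => ?_⟩
  have := h (e x) (e y)
  rw [← he, ← he, LinearEquiv.symm_apply_apply, LinearEquiv.symm_apply_apply] at this
  rw [this]
  have h2 := he (flagBracket n a b c d (e x) (e y))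
  simp only [flagBracket_apply] at h2
  rw [← h2, LinearEquiv.apply_symm_apply]

/-- Only the bracket table matters, not independence, so the same computation serves abstract
algebras and families of operators. The parameters b, c, d are free because e₃ and e₄ of the family
do not exist in dimension three. -/
lemma lie_sum_three {e₁ e₂ e₃ : 𝔤} {a : ℂ} (h12 : ⁅e₁, e₂⁆ = a • e₃) (h13 : ⁅e₁, e₃⁆ = 0)
    (h23 : ⁅e₂, e₃⁆ = 0) (b c d : ℂ) (s t : Fin 3 → ℂ) :
    ⁅∑ i, s i • ![e₁, e₂, e₃] i, ∑ i, t i • ![e₁, e₂, e₃] i⁆ =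
      ∑ i, flagFun 3 a b c d s t i • ![e₁, e₂, e₃] i := by
  have h21 : ⁅e₂, e₁⁆ = -(a • e₃) := by rw [← lie_skew, h12]
  have h31 : ⁅e₃, e₁⁆ = 0 := by rw [← lie_skew, h13, neg_zero]
  have h32 : ⁅e₃, e₂⁆ = 0 := by rw [← lie_skew, h23, neg_zero]
  simp [Fin.sum_univ_three, flagFun, minor, coord_eq, h12, h13, h23, h21, h31, h32]
  module

lemma lie_sum_four {e₁ e₂ e₃ e₄ : 𝔤} {a b : ℂ} (h12 : ⁅e₁, e₂⁆ = a • e₃)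
    (h13 : ⁅e₁, e₃⁆ = b • e₄) (h14 : ⁅e₁, e₄⁆ = 0) (h23 : ⁅e₂, e₃⁆ = 0) (h24 : ⁅e₂, e₄⁆ = 0)
    (h34 : ⁅e₃, e₄⁆ = 0) (c d : ℂ) (s t : Fin 4 → ℂ) :
    ⁅∑ i, s i • ![e₁, e₂, e₃, e₄] i, ∑ i, t i • ![e₁, e₂, e₃, e₄] i⁆ =
      ∑ i, flagFun 4 a b c d s t i • ![e₁, e₂, e₃, e₄] i := by
  have h21 : ⁅e₂, e₁⁆ = -(a • e₃) := by rw [← lie_skew, h12]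
  have h31 : ⁅e₃, e₁⁆ = -(b • e₄) := by rw [← lie_skew, h13]
  have h32 : ⁅e₃, e₂⁆ = 0 := by rw [← lie_skew, h23, neg_zero]
  have h41 : ⁅e₄, e₁⁆ = 0 := by rw [← lie_skew, h14, neg_zero]
  have h42 : ⁅e₄, e₂⁆ = 0 := by rw [← lie_skew, h24, neg_zero]
  have h43 : ⁅e₄, e₃⁆ = 0 := by rw [← lie_skew, h34, neg_zero]
  simp [Fin.sum_univ_four, flagFun, minor, coord_eq, h12, h13, h23, h14, h24, h34, h21, h31, h32,
    h41, h42, h43]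
  module

lemma lie_sum_five {e₁ e₂ e₃ e₄ e₅ : 𝔤} {a b c d : ℂ} (h12 : ⁅e₁, e₂⁆ = a • e₃)
    (h13 : ⁅e₁, e₃⁆ = b • e₄) (h14 : ⁅e₁, e₄⁆ = c • e₅) (h23 : ⁅e₂, e₃⁆ = d • e₅)
    (h24 : ⁅e₂, e₄⁆ = 0) (h34 : ⁅e₃, e₄⁆ = 0) (h15 : ⁅e₁, e₅⁆ = 0) (h25 : ⁅e₂, e₅⁆ = 0)
    (h35 : ⁅e₃, e₅⁆ = 0) (h45 : ⁅e₄, e₅⁆ = 0) (s t : Fin 5 → ℂ) :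
    ⁅∑ i, s i • ![e₁, e₂, e₃, e₄, e₅] i, ∑ i, t i • ![e₁, e₂, e₃, e₄, e₅] i⁆ =
      ∑ i, flagFun 5 a b c d s t i • ![e₁, e₂, e₃, e₄, e₅] i := by
  have h21 : ⁅e₂, e₁⁆ = -(a • e₃) := by rw [← lie_skew, h12]
  have h31 : ⁅e₃, e₁⁆ = -(b • e₄) := by rw [← lie_skew, h13]
  have h32 : ⁅e₃, e₂⁆ = -(d • e₅) := by rw [← lie_skew, h23]
  have h41 : ⁅e₄, e₁⁆ = -(c • e₅) := by rw [← lie_skew, h14]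
  have h42 : ⁅e₄, e₂⁆ = 0 := by rw [← lie_skew, h24, neg_zero]
  have h43 : ⁅e₄, e₃⁆ = 0 := by rw [← lie_skew, h34, neg_zero]
  have h51 : ⁅e₅, e₁⁆ = 0 := by rw [← lie_skew, h15, neg_zero]
  have h52 : ⁅e₅, e₂⁆ = 0 := by rw [← lie_skew, h25, neg_zero]
  have h53 : ⁅e₅, e₃⁆ = 0 := by rw [← lie_skew, h35, neg_zero]
  have h54 : ⁅e₅, e₄⁆ = 0 := by rw [← lie_skew, h45, neg_zero]
  simp [Fin.sum_univ_five, flagFun, minor, coord_eq, h12, h13, h23, h14, h24, h34, h21, h31, h32,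
    h41, h42, h43, h15, h25, h35, h45, h51, h52, h53, h54]
  module

lemma hasFlagForm_three [FiniteDimensional ℂ 𝔤] (hn : Module.finrank ℂ 𝔤 = 3) {a : ℂ}
    {e₁ e₂ e₃ : 𝔤} (hs : ∀ x : 𝔤, ∃ r s t : ℂ, x = r • e₁ + s • e₂ + t • e₃)
    (h12 : ⁅e₁, e₂⁆ = a • e₃) (h13 : ⁅e₁, e₃⁆ = 0) (h23 : ⁅e₂, e₃⁆ = 0) (b c d : ℂ) :
    HasFlagForm 3 𝔤 a b c d := by
  refine hasFlagForm_of_spanning hn ![e₁, e₂, e₃] (fun x => ?_) (lie_sum_three h12 h13 h23 b c d)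
  obtain ⟨r, s, t, rfl⟩ := hs x
  exact ⟨![r, s, t], by simp [Fin.sum_univ_three]⟩

lemma hasFlagForm_four [FiniteDimensional ℂ 𝔤] (hn : Module.finrank ℂ 𝔤 = 4) {a b : ℂ}
    {e₁ e₂ e₃ e₄ : 𝔤} (hs : ∀ x : 𝔤, ∃ r s t p : ℂ, x = r • e₁ + s • e₂ + t • e₃ + p • e₄)
    (h12 : ⁅e₁, e₂⁆ = a • e₃) (h13 : ⁅e₁, e₃⁆ = b • e₄) (h14 : ⁅e₁, e₄⁆ = 0)
    (h23 : ⁅e₂, e₃⁆ = 0) (h24 : ⁅e₂, e₄⁆ = 0) (h34 : ⁅e₃, e₄⁆ = 0) (c d : ℂ) :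
    HasFlagForm 4 𝔤 a b c d := by
  refine hasFlagForm_of_spanning hn ![e₁, e₂, e₃, e₄] (fun x => ?_)
    (lie_sum_four h12 h13 h14 h23 h24 h34 c d)
  obtain ⟨r, s, t, p, rfl⟩ := hs x
  exact ⟨![r, s, t, p], by simp [Fin.sum_univ_four]⟩

lemma hasFlagForm_five [FiniteDimensional ℂ 𝔤] (hn : Module.finrank ℂ 𝔤 = 5) {a b c d : ℂ}
    {e₁ e₂ e₃ e₄ e₅ : 𝔤}
    (hs : ∀ x : 𝔤, ∃ r s t p q : ℂ, x = r • e₁ + s • e₂ + t • e₃ + p • e₄ + q • e₅)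
    (h12 : ⁅e₁, e₂⁆ = a • e₃) (h13 : ⁅e₁, e₃⁆ = b • e₄) (h14 : ⁅e₁, e₄⁆ = c • e₅)
    (h23 : ⁅e₂, e₃⁆ = d • e₅) (h24 : ⁅e₂, e₄⁆ = 0) (h34 : ⁅e₃, e₄⁆ = 0)
    (h5 : ∀ x : 𝔤, ⁅x, e₅⁆ = 0) :
    HasFlagForm 5 𝔤 a b c d := by
  refine hasFlagForm_of_spanning hn ![e₁, e₂, e₃, e₄, e₅] (fun x => ?_)
    (lie_sum_five h12 h13 h14 h23 h24 h34 (h5 _) (h5 _) (h5 _) (h5 _))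
  obtain ⟨r, s, t, p, q, rfl⟩ := hs x
  exact ⟨![r, s, t, p, q], by simp [Fin.sum_univ_five]⟩

/-- The bracket table of a four-dimensional nilpotent Lie algebra. -/
def FourTable (e₁ e₂ e₃ e₄ : 𝔤) : Prop :=
  (∀ x : 𝔤, ∃ r s t p : ℂ, x = r • e₁ + s • e₂ + t • e₃ + p • e₄) ∧
    ⁅e₁, e₄⁆ = 0 ∧ ⁅e₂, e₃⁆ = 0 ∧ ⁅e₂, e₄⁆ = 0 ∧ ⁅e₃, e₄⁆ = 0 ∧
    (⁅e₁, e₂⁆ = 0 ∧ ⁅e₁, e₃⁆ = 0 ∨ ⁅e₁, e₂⁆ = e₃ ∧ ⁅e₁, e₃⁆ = 0 ∨ ⁅e₁, e₂⁆ = e₃ ∧ ⁅e₁, e₃⁆ = e₄)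

/-- The plane of w₁, w₂ is nondegenerate for the bracket form, so w₃ can be corrected within it to
commute with both. The result is a Heisenberg algebra plus a central line. -/
lemma exists_fourTable_of_scalar {w₁ w₂ w₃ z : 𝔤} (hz : ∀ x : 𝔤, ⁅x, z⁆ = 0)
    (hs : ∀ x : 𝔤, ∃ r s t p : ℂ, x = r • w₁ + s • w₂ + t • w₃ + p • z) {α β γ : ℂ}
    (h12 : ⁅w₁, w₂⁆ = α • z) (h13 : ⁅w₁, w₃⁆ = β • z) (h23 : ⁅w₂, w₃⁆ = γ • z) (hα : α ≠ 0) :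
    ∃ e₁ e₂ e₃ e₄ : 𝔤, FourTable e₁ e₂ e₃ e₄ := by
  have h21 : ⁅w₂, w₁⁆ = -(α • z) := by rw [← lie_skew, h12]
  refine ⟨w₁, w₂, α • z, w₃ + (γ / α) • w₁ - (β / α) • w₂, fun x => ?_, ?_, by simp [hz], ?_, ?_,
    Or.inr (Or.inl ⟨h12, by simp [hz]⟩)⟩
  · obtain ⟨r, s, t, p, rfl⟩ := hs x
    refine ⟨r - t * (γ / α), s + t * (β / α), p / α, t, ?_⟩
    rw [smul_smul, div_mul_cancel₀ _ hα]
    module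
  · simp [h12, h13, smul_smul, div_mul_cancel₀ _ hα]
  · simp [h21, h23, smul_smul, div_mul_cancel₀ _ hα]
  · rw [← lie_skew]; simp [hz]

/-- Since [w₁,w₃] ≠ 0, a multiple of w₁ subtracted from w₂ makes it commute with w₃ without changing
[w₁,w₂]. The result is filiform. -/
lemma exists_fourTable_of_heisenberg {w₁ w₂ w₃ z : 𝔤} (hz : ∀ x : 𝔤, ⁅x, z⁆ = 0)
    (hs : ∀ x : 𝔤, ∃ r s t p : ℂ, x = r • w₁ + s • w₂ + t • w₃ + p • z) {β γ : ℂ}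
    (h12 : ⁅w₁, w₂⁆ = w₃) (h13 : ⁅w₁, w₃⁆ = β • z) (h23 : ⁅w₂, w₃⁆ = γ • z) (hβ : β ≠ 0) :
    ∃ e₁ e₂ e₃ e₄ : 𝔤, FourTable e₁ e₂ e₃ e₄ := by
  refine ⟨w₁, w₂ - (γ / β) • w₁, w₃, β • z, fun x => ?_, by simp [hz], ?_, by simp [hz],
    by simp [hz], Or.inr (Or.inr ⟨by simp [h12], h13⟩)⟩
  · obtain ⟨r, s, t, p, rfl⟩ := hs x
    refine ⟨r + s * (γ / β), s, t, p / β, ?_⟩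
    rw [smul_smul, div_mul_cancel₀ _ hβ]
    module
  · simp [h13, h23, smul_smul, div_mul_cancel₀ _ hβ]

variable [FiniteDimensional ℂ 𝔤]

lemma exists_spanning_one (hn : Module.finrank ℂ 𝔤 = 1) :
    ∃ e₁ : 𝔤, ∀ x : 𝔤, ∃ r : ℂ, x = r • e₁ := by
  obtain ⟨v, -, hv⟩ := finrank_eq_one_iff'.1 hn
  exact ⟨v, fun x => (hv x).imp fun _ h => h.symm⟩

variable [LieRing.IsNilpotent 𝔤]

lemma exists_spanning_two (hn : Module.finrank ℂ 𝔤 = 2) :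
    ∃ e₁ e₂ : 𝔤, (∀ x : 𝔤, ∃ r s : ℂ, x = r • e₁ + s • e₂) ∧ ⁅e₁, e₂⁆ = 0 := by
  obtain ⟨z, 𝔥, _, _, π, _, _, h1, hπ, hz, hk⟩ := exists_central_quotient hn
  obtain ⟨v, hv⟩ := exists_spanning_one h1
  obtain ⟨w, rfl⟩ := hπ v
  refine ⟨w, z, fun x => ?_, hz w⟩
  obtain ⟨r, hr⟩ := hv (π x)
  obtain ⟨t, ht⟩ := hk (x - r • w) (by simp [hr])
  exact ⟨r, t, by rw [← ht]; abel⟩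

lemma exists_spanning_three (hn : Module.finrank ℂ 𝔤 = 3) :
    ∃ e₁ e₂ e₃ : 𝔤, (∀ x : 𝔤, ∃ r s t : ℂ, x = r • e₁ + s • e₂ + t • e₃) ∧
      ⁅e₁, e₃⁆ = 0 ∧ ⁅e₂, e₃⁆ = 0 ∧ (⁅e₁, e₂⁆ = 0 ∨ ⁅e₁, e₂⁆ = e₃) := by
  obtain ⟨z, 𝔥, _, _, π, _, _, h1, hπ, hz, hk⟩ := exists_central_quotient hn
  obtain ⟨v₁, v₂, hv, h12⟩ := exists_spanning_two h1
  obtain ⟨w₁, rfl⟩ := hπ v₁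
  obtain ⟨w₂, rfl⟩ := hπ v₂
  have hs : ∀ x : 𝔤, ∃ r s t : ℂ, x = r • w₁ + s • w₂ + t • z := by
    intro x
    obtain ⟨r, s, hr⟩ := hv (π x)
    obtain ⟨t, ht⟩ := hk (x - (r • w₁ + s • w₂)) (by simp [hr])
    exact ⟨r, s, t, by rw [← ht]; abel⟩
  obtain ⟨α, hα⟩ := hk ⁅w₁, w₂⁆ (by rw [LieHom.map_lie, h12])
  by_cases h0 : α = 0
  · exact ⟨w₁, w₂, z, hs, hz _, hz _, Or.inl (by rw [hα, h0, zero_smul])⟩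
  · refine ⟨w₁, w₂, α • z, fun x => ?_, by simp [hz], by simp [hz], Or.inr hα⟩
    obtain ⟨r, s, t, rfl⟩ := hs x
    exact ⟨r, s, t * α⁻¹, by rw [smul_smul, mul_assoc, inv_mul_cancel₀ h0, mul_one]⟩

/-- If the three-dimensional quotient is abelian, the bracket is an alternating form on three
vectors with values in ℂz: either zero or, after a permutation, nonzero on the first two. If it is
Heisenberg, the only new data are the brackets of w₁, w₂ with w₃. -/
lemma exists_fourTable (hn : Module.finrank ℂ 𝔤 = 4) : ∃ e₁ e₂ e₃ e₄ : 𝔤, FourTable e₁ e₂ e₃ e₄ := by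
  obtain ⟨z, 𝔥, _, _, π, _, _, h1, hπ, hz, hk⟩ := exists_central_quotient hn
  obtain ⟨v₁, v₂, v₃, hv, h13, h23, h12⟩ := exists_spanning_three h1
  obtain ⟨w₁, rfl⟩ := hπ v₁
  obtain ⟨w₂, rfl⟩ := hπ v₂
  obtain ⟨w₃, rfl⟩ := hπ v₃
  have hs : ∀ x : 𝔤, ∃ r s t p : ℂ, x = r • w₁ + s • w₂ + t • w₃ + p • z := by
    intro x
    obtain ⟨r, s, t, hr⟩ := hv (π x)
    obtain ⟨p, hp⟩ := hk (x - (r • w₁ + s • w₂ + t • w₃)) (by simp [hr])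
    exact ⟨r, s, t, p, by rw [← hp]; abel⟩
  obtain ⟨β, hβ⟩ := hk ⁅w₁, w₃⁆ (by rw [LieHom.map_lie, h13])
  obtain ⟨γ, hγ⟩ := hk ⁅w₂, w₃⁆ (by rw [LieHom.map_lie, h23])
  rcases h12 with h12 | h12
  · obtain ⟨α, hα⟩ := hk ⁅w₁, w₂⁆ (by rw [LieHom.map_lie, h12])
    by_cases hα0 : α = 0
    · by_cases hβ0 : β = 0
      · by_cases hγ0 : γ = 0
        · subst hα0 hβ0 hγ0
          rw [zero_smul] at hα hβ hγ
          exact ⟨w₁, w₂, w₃, z, hs, hz _, hγ, hz _, hz _, Or.inl ⟨hα, hβ⟩⟩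
        · refine exists_fourTable_of_scalar (w₁ := w₂) (w₂ := w₃) (w₃ := w₁) hz (fun x => ?_) hγ
            (β := -α) (γ := -β) (by rw [← lie_skew, hα, neg_smul])
            (by rw [← lie_skew, hβ, neg_smul]) hγ0
          obtain ⟨r, s, t, p, rfl⟩ := hs x
          exact ⟨s, t, r, p, by abel⟩
      · refine exists_fourTable_of_scalar (w₁ := w₁) (w₂ := w₃) (w₃ := w₂) hz (fun x => ?_) hβ
          (β := α) (γ := -γ) hα (by rw [← lie_skew, hγ, neg_smul]) hβ0
        obtain ⟨r, s, t, p, rfl⟩ := hs x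
        exact ⟨r, t, s, p, by abel⟩
    · exact exists_fourTable_of_scalar hz hs hα hβ hγ hα0
  -- The lift w₃ agrees with [w₁,w₂] only modulo z; from here on [w₁,w₂] itself replaces it.
  · obtain ⟨κ, hκ⟩ := hk (⁅w₁, w₂⁆ - w₃) (by rw [map_sub, LieHom.map_lie, h12, sub_self])
    have hs' : ∀ x : 𝔤, ∃ r s t p : ℂ, x = r • w₁ + s • w₂ + t • ⁅w₁, w₂⁆ + p • z := by
      intro x
      obtain ⟨r, s, t, p, rfl⟩ := hs x
      refine ⟨r, s, t, p - t * κ, ?_⟩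
      rw [sub_eq_iff_eq_add.1 hκ]
      module
    have hβ' : ⁅w₁, ⁅w₁, w₂⁆⁆ = β • z := by
      rw [sub_eq_iff_eq_add.1 hκ]; simp [hz, hβ]
    have hγ' : ⁅w₂, ⁅w₁, w₂⁆⁆ = γ • z := by
      rw [sub_eq_iff_eq_add.1 hκ]; simp [hz, hγ]
    by_cases hβ0 : β = 0
    · by_cases hγ0 : γ = 0
      · subst hβ0 hγ0
        rw [zero_smul] at hβ' hγ'
        exact ⟨w₁, w₂, ⁅w₁, w₂⁆, z, hs', hz _, hγ', hz _, hz _, Or.inr (Or.inl ⟨rfl, hβ'⟩)⟩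
      -- The quarter turn (w₂, −w₁) has the same bracket as (w₁, w₂) and moves the nonzero
      -- coefficient γ to the first place.
      · refine exists_fourTable_of_heisenberg (w₁ := w₂) (w₂ := -w₁) (w₃ := ⁅w₁, w₂⁆) hz
          (fun x => ?_) (by rw [lie_neg, lie_skew]) hγ' (γ := -β)
          (by rw [neg_lie, hβ', neg_smul]) hγ0
        obtain ⟨r, s, t, p, rfl⟩ := hs' x
        exact ⟨s, -r, t, p, by module⟩
    · exact exists_fourTable_of_heisenberg hz hs' rfl hβ' hγ' hβ0

end Cases

/-! ### Dimension five, according to the central quotient. -/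

section Cases

variable {𝔤 : Type u} [LieRing 𝔤] [LieAlgebra ℂ 𝔤] [FiniteDimensional ℂ 𝔤]

/-- The case of a derived algebra contained in a central line. -/
lemma exists_flagForm_of_scalar (hn : Module.finrank ℂ 𝔤 = 5) {w₁ w₂ w₃ w₄ z : 𝔤}
    (hz : ∀ x : 𝔤, ⁅x, z⁆ = 0)
    (hs : ∀ x : 𝔤, ∃ r s t p q : ℂ, x = r • w₁ + s • w₂ + t • w₃ + p • w₄ + q • z)
    (hc : ∀ x y : 𝔤, ∃ t : ℂ, ⁅x, y⁆ = t • z) (h0 : ⁅w₁, w₂⁆ ≠ 0) :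
    ∃ a b c d, HasFlagForm 5 𝔤 a b c d := by
  obtain ⟨α, hα⟩ := hc w₁ w₂
  have hα0 : α ≠ 0 := by rintro rfl; exact h0 (by rw [hα, zero_smul])
  have h21 : ⁅w₂, w₁⁆ = -(α • z) := by rw [← lie_skew, hα]
  -- Symplectic Gram–Schmidt: every vector can be corrected within the nondegenerate plane of w₁, w₂
  -- to commute with both.
  have key : ∀ u : 𝔤, ∃ p q : ℂ, ⁅w₁, u + p • w₁ + q • w₂⁆ = 0 ∧ ⁅w₂, u + p • w₁ + q • w₂⁆ = 0 := by
    intro u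
    obtain ⟨β, hβ⟩ := hc w₁ u
    obtain ⟨γ, hγ⟩ := hc w₂ u
    refine ⟨γ / α, -(β / α), ?_, ?_⟩
    · simp [hα, hβ, smul_smul, div_mul_cancel₀ _ hα0]
    · simp [h21, hγ, smul_smul, div_mul_cancel₀ _ hα0]
  obtain ⟨p₃, q₃, h13, h23⟩ := key w₃
  obtain ⟨p₄, q₄, h14, h24⟩ := key w₄
  obtain ⟨δ, hδ⟩ := hc (w₃ + p₃ • w₁ + q₃ • w₂) (w₄ + p₄ • w₁ + q₄ • w₂)
  -- The form is now block diagonal with values α on (w₁, w₂) and δ, possibly zero, on the other two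
  -- vectors. The blocks go to the slots (e₀,e₃) and (e₁,e₂), whose brackets both land in e₄.
  refine ⟨0, 0, α, δ, hasFlagForm_five hn (e₁ := w₁) (e₄ := w₂) (e₂ := w₃ + p₃ • w₁ + q₃ • w₂)
    (e₃ := w₄ + p₄ • w₁ + q₄ • w₂) (e₅ := z) (fun x => ?_) ?_ ?_ hα hδ ?_ ?_ hz⟩
  · obtain ⟨r, s, t, p, q, rfl⟩ := hs x
    exact ⟨r - t * p₃ - p * p₄, t, p, s - t * q₃ - p * q₄, q, by module⟩
  · rw [h13, zero_smul]
  · rw [h14, zero_smul]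
  · rw [← lie_skew, h23, neg_zero]
  · rw [← lie_skew, h24, neg_zero]

/-- With [w₂,w₃] ≠ 0, a multiple of w₂ removes [w₁,w₃] and a multiple of w₃ removes [w₂,w₄]. What
survives of [w₁,w₄] becomes c. -/
lemma exists_flagForm_of_heisenberg_left (hn : Module.finrank ℂ 𝔤 = 5) {w₁ w₂ w₃ w₄ z : 𝔤}
    (hz : ∀ x : 𝔤, ⁅x, z⁆ = 0)
    (hs : ∀ x : 𝔤, ∃ r s t p q : ℂ, x = r • w₁ + s • w₂ + t • w₃ + p • w₄ + q • z)
    (h12 : ⁅w₁, w₂⁆ = w₃) (h34 : ⁅w₃, w₄⁆ = 0) {α₁ α₂ β₁ β₂ : ℂ} (h13 : ⁅w₁, w₃⁆ = α₁ • z)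
    (h23 : ⁅w₂, w₃⁆ = α₂ • z) (h14 : ⁅w₁, w₄⁆ = β₁ • z) (h24 : ⁅w₂, w₄⁆ = β₂ • z) (hα : α₂ ≠ 0) :
    ∃ a b c d, HasFlagForm 5 𝔤 a b c d := by
  have h32 : ⁅w₃, w₂⁆ = -(α₂ • z) := by rw [← lie_skew, h23]
  have h21 : ⁅w₂, w₁⁆ = -w₃ := by rw [← lie_skew, h12]
  refine ⟨1, 0, β₁ - α₁ / α₂ * β₂, α₂, hasFlagForm_five hn (e₁ := w₁ - (α₁ / α₂) • w₂) (e₂ := w₂)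
    (e₃ := w₃) (e₄ := w₄ - (β₂ / α₂) • w₃) (e₅ := z) (fun x => ?_) ?_ ?_ ?_ h23 ?_ ?_ hz⟩
  · obtain ⟨r, s, t, p, q, rfl⟩ := hs x
    exact ⟨r, s + r * (α₁ / α₂), t + p * (β₂ / α₂), p, q, by module⟩
  · simp [h12]
  · simp [h13, h23, smul_smul, div_mul_cancel₀ _ hα]
  · simp [h13, h14, h23, h24, smul_smul, div_mul_cancel₀ _ hα]
    module
  · simp [h24, h23, smul_smul, div_mul_cancel₀ _ hα]
  · simp [h34]

/-- Here w₃ commutes with w₁ and w₂. As [w₁,w₄] ≠ 0, subtracting a multiple of w₁ from w₂ removes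
[w₂,w₄] and leaves [w₁,w₂] unchanged. -/
lemma exists_flagForm_of_heisenberg_right (hn : Module.finrank ℂ 𝔤 = 5) {w₁ w₂ w₃ w₄ z : 𝔤}
    (hz : ∀ x : 𝔤, ⁅x, z⁆ = 0)
    (hs : ∀ x : 𝔤, ∃ r s t p q : ℂ, x = r • w₁ + s • w₂ + t • w₃ + p • w₄ + q • z)
    (h12 : ⁅w₁, w₂⁆ = w₃) (h34 : ⁅w₃, w₄⁆ = 0) {β₁ β₂ : ℂ} (h13 : ⁅w₁, w₃⁆ = 0)
    (h23 : ⁅w₂, w₃⁆ = 0) (h14 : ⁅w₁, w₄⁆ = β₁ • z) (h24 : ⁅w₂, w₄⁆ = β₂ • z) (hβ : β₁ ≠ 0) :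
    ∃ a b c d, HasFlagForm 5 𝔤 a b c d := by
  refine ⟨1, 0, β₁, 0, hasFlagForm_five hn (e₁ := w₁) (e₂ := w₂ - (β₂ / β₁) • w₁)
    (e₃ := w₃) (e₄ := w₄) (e₅ := z) (fun x => ?_) ?_ ?_ h14 ?_ ?_ h34 hz⟩
  · obtain ⟨r, s, t, p, q, rfl⟩ := hs x
    exact ⟨r + s * (β₂ / β₁), s, t, p, q, by module⟩
  · simp [h12]
  · simp [h13]
  · simp [h13, h23]
  · simp [h24, h14, smul_smul, div_mul_cancel₀ _ hβ]

/-- The case of a central quotient isomorphic to the sum of a Heisenberg algebra and a line. -/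
lemma exists_flagForm_of_heisenberg (hn : Module.finrank ℂ 𝔤 = 5) {w₁ w₂ w₃ w₄ z : 𝔤}
    (hz : ∀ x : 𝔤, ⁅x, z⁆ = 0)
    (hs : ∀ x : 𝔤, ∃ r s t p q : ℂ, x = r • w₁ + s • w₂ + t • w₃ + p • w₄ + q • z)
    (h12 : ⁅w₁, w₂⁆ = w₃) {α₁ α₂ β₁ β₂ : ℂ} (h13 : ⁅w₁, w₃⁆ = α₁ • z)
    (h23 : ⁅w₂, w₃⁆ = α₂ • z) (h14 : ⁅w₁, w₄⁆ = β₁ • z) (h24 : ⁅w₂, w₄⁆ = β₂ • z) :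
    ∃ a b c d, HasFlagForm 5 𝔤 a b c d := by
  -- By Jacobi, [[w₁,w₂],w₄] is made of brackets with multiples of the central z.
  have h34 : ⁅w₃, w₄⁆ = 0 := by
    rw [← h12, lie_lie, h14, h24]
    simp [hz]
  -- The pair (w₂, −w₁) also has bracket w₃; it exchanges the roles of the two generators below.
  have hs' : ∀ x : 𝔤, ∃ r s t p q : ℂ, x = r • w₂ + s • -w₁ + t • w₃ + p • w₄ + q • z := by
    intro x
    obtain ⟨r, s, t, p, q, rfl⟩ := hs x
    exact ⟨s, -r, t, p, q, by module⟩
  have h12' : ⁅w₂, -w₁⁆ = w₃ := by rw [lie_neg, lie_skew, h12]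
  by_cases hα₂ : α₂ = 0
  · by_cases hα₁ : α₁ = 0
    · subst hα₁ hα₂
      rw [zero_smul] at h13 h23
      by_cases hβ₁ : β₁ = 0
      · by_cases hβ₂ : β₂ = 0
        · subst hβ₁ hβ₂
          exact ⟨1, 0, 0, 0, hasFlagForm_five hn hs (by simpa using h12) (by simpa using h13)
            (by simpa using h14) (by simpa using h23) (by simpa using h24) h34 hz⟩
        · exact exists_flagForm_of_heisenberg_right hn hz hs' h12' h34 h23
            (by rw [neg_lie, h13, neg_zero]) h24
            (β₂ := -β₁) (by rw [neg_lie, h14, neg_smul]) hβ₂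
      · exact exists_flagForm_of_heisenberg_right hn hz hs h12 h34 h13 h23 h14 h24 hβ₁
    · exact exists_flagForm_of_heisenberg_left hn hz hs' h12' h34 h23
        (α₂ := -α₁) (by rw [neg_lie, h13, neg_smul]) h24 (β₂ := -β₁)
        (by rw [neg_lie, h14, neg_smul]) (neg_ne_zero.2 hα₁)
  · exact exists_flagForm_of_heisenberg_left hn hz hs h12 h34 h13 h23 h14 h24 hα₂

/-- The case of a filiform central quotient. -/
lemma exists_flagForm_of_filiform (hn : Module.finrank ℂ 𝔤 = 5) {w₁ w₂ w₃ w₄ z : 𝔤}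
    (hz : ∀ x : 𝔤, ⁅x, z⁆ = 0)
    (hs : ∀ x : 𝔤, ∃ r s t p q : ℂ, x = r • w₁ + s • w₂ + t • w₃ + p • w₄ + q • z)
    (h12 : ⁅w₁, w₂⁆ = w₃) (h13 : ⁅w₁, w₃⁆ = w₄) {c d f : ℂ}
    (h14 : ⁅w₁, w₄⁆ = c • z) (h23 : ⁅w₂, w₃⁆ = d • z) (h24 : ⁅w₂, w₄⁆ = f • z) :
    HasFlagForm 5 𝔤 1 1 c d := by
  -- Jacobi for w₂ and w₄ = [w₁,w₃] leaves −[w₃,w₃] plus a bracket with a multiple of z. So the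
  -- coefficient of [w₂,w₄], which has no place in the family, vanishes.
  have h24' : ⁅w₂, w₄⁆ = 0 := by
    rw [← h13, leibniz_lie, h23, ← lie_skew w₂ w₁, h12]
    simp [hz]
  have h34 : ⁅w₃, w₄⁆ = 0 := by
    rw [← h12, lie_lie, h14, h24]
    simp [hz]
  exact hasFlagForm_five hn hs (by simpa using h12) (by simpa using h13) h14 h23 h24' h34 hz

/-- The three tables of the quotient give three cases. An abelian quotient leaves an alternating
form on four vectors; the Heisenberg-plus-line quotient needs a change of basis; the filiform
quotient fits directly with a = b = 1. -/
lemma exists_flagForm_five [LieRing.IsNilpotent 𝔤] (hn : Module.finrank ℂ 𝔤 = 5) :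
    ∃ a b c d, HasFlagForm 5 𝔤 a b c d := by
  obtain ⟨z, 𝔥, _, _, π, _, _, h1, hπ, hz, hk⟩ := exists_central_quotient hn
  obtain ⟨v₁, v₂, v₃, v₄, hv, h14, h23, h24, h34, htab⟩ := exists_fourTable h1
  obtain ⟨w₁, rfl⟩ := hπ v₁
  obtain ⟨w₂, rfl⟩ := hπ v₂
  obtain ⟨w₃, rfl⟩ := hπ v₃
  obtain ⟨w₄, rfl⟩ := hπ v₄
  have hs : ∀ x : 𝔤, ∃ r s t p q : ℂ, x = r • w₁ + s • w₂ + t • w₃ + p • w₄ + q • z := by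
    intro x
    obtain ⟨r, s, t, p, hr⟩ := hv (π x)
    obtain ⟨q, hq⟩ := hk (x - (r • w₁ + s • w₂ + t • w₃ + p • w₄)) (by simp [hr])
    exact ⟨r, s, t, p, q, by rw [← hq]; abel⟩
  obtain ⟨c, hc⟩ := hk ⁅w₁, w₄⁆ (by rw [LieHom.map_lie, h14])
  obtain ⟨d, hd⟩ := hk ⁅w₂, w₃⁆ (by rw [LieHom.map_lie, h23])
  obtain ⟨f, hf⟩ := hk ⁅w₂, w₄⁆ (by rw [LieHom.map_lie, h24])
  obtain ⟨g, hg⟩ := hk ⁅w₃, w₄⁆ (by rw [LieHom.map_lie, h34])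
  rcases htab with ⟨h12, h13⟩ | ⟨h12, h13⟩ | ⟨h12, h13⟩
  · obtain ⟨a, ha⟩ := hk ⁅w₁, w₂⁆ (by rw [LieHom.map_lie, h12])
    obtain ⟨b, hb⟩ := hk ⁅w₁, w₃⁆ (by rw [LieHom.map_lie, h13])
    have hsc : ∀ x y : 𝔤, ∃ t : ℂ, ⁅x, y⁆ = t • z := by
      intro x y
      refine hk _ ?_
      obtain ⟨r, s, t, p, hx⟩ := hv (π x)
      obtain ⟨r', s', t', p', hy⟩ := hv (π y)
      have h21 : ⁅π w₂, π w₁⁆ = 0 := by rw [← lie_skew, h12, neg_zero]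
      have h31 : ⁅π w₃, π w₁⁆ = 0 := by rw [← lie_skew, h13, neg_zero]
      have h41 : ⁅π w₄, π w₁⁆ = 0 := by rw [← lie_skew, h14, neg_zero]
      have h32 : ⁅π w₃, π w₂⁆ = 0 := by rw [← lie_skew, h23, neg_zero]
      have h42 : ⁅π w₄, π w₂⁆ = 0 := by rw [← lie_skew, h24, neg_zero]
      have h43 : ⁅π w₄, π w₃⁆ = 0 := by rw [← lie_skew, h34, neg_zero]
      rw [LieHom.map_lie, hx, hy]
      simp [h12, h13, h14, h23, h24, h34, h21, h31, h41, h32, h42, h43]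
    by_cases h12 : ⁅w₁, w₂⁆ = 0
    · by_cases h13 : ⁅w₁, w₃⁆ = 0
      · by_cases h24 : ⁅w₂, w₄⁆ = 0
        · by_cases h34 : ⁅w₃, w₄⁆ = 0
          -- Only [w₁,w₄] and [w₂,w₃] are left, and these are exactly the slots of c and d. If
          -- another bracket is nonzero, its pair starts the Gram–Schmidt step.
          · exact ⟨0, 0, c, d, hasFlagForm_five hn hs (by simpa using h12) (by simpa using h13)
              hc hd h24 h34 hz⟩
          · refine exists_flagForm_of_scalar hn (w₁ := w₃) (w₂ := w₄) (w₃ := w₁) (w₄ := w₂) hz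
              (fun x => ?_) hsc h34
            obtain ⟨r, s, t, p, q, rfl⟩ := hs x
            exact ⟨t, p, r, s, q, by abel⟩
        · refine exists_flagForm_of_scalar hn (w₁ := w₂) (w₂ := w₄) (w₃ := w₁) (w₄ := w₃) hz
            (fun x => ?_) hsc h24
          obtain ⟨r, s, t, p, q, rfl⟩ := hs x
          exact ⟨s, p, r, t, q, by abel⟩
      · refine exists_flagForm_of_scalar hn (w₁ := w₁) (w₂ := w₃) (w₃ := w₂) (w₄ := w₄) hz
          (fun x => ?_) hsc h13
        obtain ⟨r, s, t, p, q, rfl⟩ := hs x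
        exact ⟨r, t, s, p, q, by abel⟩
    · exact exists_flagForm_of_scalar hn hz hs hsc h12
  · obtain ⟨κ, hκ⟩ := hk (⁅w₁, w₂⁆ - w₃) (by rw [map_sub, LieHom.map_lie, h12, sub_self])
    obtain ⟨b, hb⟩ := hk ⁅w₁, w₃⁆ (by rw [LieHom.map_lie, h13])
    refine exists_flagForm_of_heisenberg hn (w₃ := ⁅w₁, w₂⁆) hz (fun x => ?_) rfl (α₁ := b)
      (α₂ := d) ?_ ?_ hc hf
    · obtain ⟨r, s, t, p, q, rfl⟩ := hs x
      refine ⟨r, s, t, p, q - t * κ, ?_⟩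
      rw [sub_eq_iff_eq_add.1 hκ]
      module
    · rw [sub_eq_iff_eq_add.1 hκ]; simp [hz, hb]
    · rw [sub_eq_iff_eq_add.1 hκ]; simp [hz, hd]
  -- Both w₃ and w₄ are replaced by the iterated brackets of w₁ and w₂, from which they differ by
  -- multiples of z.
  · obtain ⟨κ, hκ⟩ := hk (⁅w₁, w₂⁆ - w₃) (by rw [map_sub, LieHom.map_lie, h12, sub_self])
    obtain ⟨l, hl⟩ := hk (⁅w₁, ⁅w₁, w₂⁆⁆ - w₄)
      (by rw [map_sub, LieHom.map_lie, LieHom.map_lie, h12, h13, sub_self])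
    refine ⟨1, 1, c, d, exists_flagForm_of_filiform hn (w₁ := w₁) (w₂ := w₂) (f := f) hz
      (fun x => ?_) rfl rfl ?_ ?_ ?_⟩
    · obtain ⟨r, s, t, p, q, rfl⟩ := hs x
      refine ⟨r, s, t, p, q - t * κ - p * l, ?_⟩
      rw [sub_eq_iff_eq_add.1 hl, sub_eq_iff_eq_add.1 hκ]
      module
    · rw [sub_eq_iff_eq_add.1 hl]; simp [hz, hc]
    · rw [sub_eq_iff_eq_add.1 hκ]; simp [hz, hd]
    · rw [sub_eq_iff_eq_add.1 hl]; simp [hz, hf]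

/-- Every nilpotent Lie algebra of dimension at most five is a member of the linear family
`flagBracket`. -/
theorem exists_flagForm [LieRing.IsNilpotent 𝔤] {n : ℕ} (h5 : n ≤ 5)
    (hn : Module.finrank ℂ 𝔤 = n) : ∃ a b c d, HasFlagForm n 𝔤 a b c d := by
  have h0 : n = 0 ∨ n = 1 ∨ n = 2 ∨ n = 3 ∨ n = 4 ∨ n = 5 := by omega
  rcases h0 with rfl | rfl | rfl | rfl | rfl | rfl
  · have := Module.finrank_zero_iff.1 hn
    refine ⟨0, 0, 0, 0, hasFlagForm_of_spanning hn Fin.elim0 (fun x => ⟨0, ?_⟩) fun s t => ?_⟩ <;>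
      exact Subsingleton.elim _ _
  · obtain ⟨e₁, hs⟩ := exists_spanning_one hn
    refine ⟨0, 0, 0, 0, hasFlagForm_of_spanning hn ![e₁] (fun x => ?_) fun s t => ?_⟩
    · obtain ⟨r, rfl⟩ := hs x
      exact ⟨![r], by simp⟩
    · simp [flagFun]
  · obtain ⟨e₁, e₂, hs, h12⟩ := exists_spanning_two hn
    refine ⟨0, 0, 0, 0, hasFlagForm_of_spanning hn ![e₁, e₂] (fun x => ?_) fun s t => ?_⟩
    · obtain ⟨r, s, rfl⟩ := hs x
      exact ⟨![r, s], by simp⟩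
    · have h21 : ⁅e₂, e₁⁆ = 0 := by rw [← lie_skew, h12, neg_zero]
      simp [flagFun, h12, h21]
  · obtain ⟨e₁, e₂, e₃, hs, h13, h23, h12⟩ := exists_spanning_three hn
    rcases h12 with h12 | h12
    · exact ⟨0, 0, 0, 0, hasFlagForm_three hn hs (by simpa using h12) h13 h23 _ _ _⟩
    · exact ⟨1, 0, 0, 0, hasFlagForm_three hn hs (by simpa using h12) h13 h23 _ _ _⟩
  · obtain ⟨e₁, e₂, e₃, e₄, hs, h14, h23, h24, h34, h | h | h⟩ := exists_fourTable hn
    · exact ⟨0, 0, 0, 0, hasFlagForm_four hn hs (by simpa using h.1) (by simpa using h.2)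
        h14 h23 h24 h34 _ _⟩
    · exact ⟨1, 0, 0, 0, hasFlagForm_four hn hs (by simpa using h.1) (by simpa using h.2)
        h14 h23 h24 h34 _ _⟩
    · exact ⟨1, 1, 0, 0, hasFlagForm_four hn hs (by simpa using h.1) (by simpa using h.2)
        h14 h23 h24 h34 _ _⟩
  · exact exists_flagForm_five hn

end Cases

/-- Any two nilpotent Lie algebras of the same dimension `n ≤ 5` are linear deformations of each
other. -/
theorem deformsTo_of_finrank_le_five {𝔤 𝔯 : Type*} [LieRing 𝔤] [LieAlgebra ℂ 𝔤]
    [FiniteDimensional ℂ 𝔤] [LieRing.IsNilpotent 𝔤] [LieRing 𝔯] [LieAlgebra ℂ 𝔯]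
    [FiniteDimensional ℂ 𝔯] [LieRing.IsNilpotent 𝔯] {n : ℕ} (h5 : n ≤ 5)
    (hg : Module.finrank ℂ 𝔤 = n) (hr : Module.finrank ℂ 𝔯 = n) : DeformsTo 𝔤 𝔯 := by
  obtain ⟨_, _, _, _, hg⟩ := exists_flagForm h5 hg
  obtain ⟨_, _, _, _, hr⟩ := exists_flagForm h5 hr
  exact hg.deformsTo hr

/-! ### Multiplication operators on `ℓ²` -/

section Mult

variable {I : Type}

/-- The Hilbert space `ℓ²(I)`. -/
abbrev EllTwo (I : Type) : Type := lp (fun _ : I => ℂ) 2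

/-- The unbounded operator on `ℓ²(I)` that multiplies by the real function `w`. -/
def multOp (w : I → ℝ) : EllTwo I →ₗ.[ℂ] EllTwo I where
  domain :=
    { carrier := {f | Memℓp (fun i => (w i : ℂ) * f i) 2}
      add_mem' := by
        intro f g hf hg
        have := Memℓp.add hf hg
        refine (congrArg (Memℓp · 2) (funext fun i => ?_)).mp this
        simp [mul_add]
      zero_mem' := by
        refine (congrArg (Memℓp · 2) (funext fun i => ?_)).mp (zero_memℓp (E := fun _ : I => ℂ))
        simp
      smul_mem' := by
        intro c f hf
        have := Memℓp.const_smul hf c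
        refine (congrArg (Memℓp · 2) (funext fun i => ?_)).mp this
        simp [mul_left_comm] }
  toFun :=
    { toFun := fun f => ⟨fun i => (w i : ℂ) * f.1 i, f.2⟩
      map_add' := fun f g => by
        ext i; simp [mul_add]; rfl
      map_smul' := fun c f => by
        ext i; simp [mul_left_comm] }

lemma mem_multOp_domain {w : I → ℝ} {f : EllTwo I} :
    f ∈ (multOp w).domain ↔ Memℓp (fun i => (w i : ℂ) * f i) 2 := Iff.rfl

lemma multOp_apply (w : I → ℝ) (f : (multOp w).domain) (i : I) :
    (multOp w f : EllTwo I) i = (w i : ℂ) * (f : EllTwo I) i := rfl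

/-- All powers j ≤ k are listed, rather than k alone, so that the induction needs no comparison
between different powers of w. -/
lemma mem_powDomain_multOp {w : I → ℝ} {k : ℕ} {f : EllTwo I} :
    f ∈ powDomain (multOp w) k ↔ ∀ j ≤ k, Memℓp (fun i => (w i : ℂ) ^ j * f i) 2 := by
  induction k generalizing f with
  | zero =>
    simp only [powDomain, Submodule.mem_top, true_iff]
    intro j hj
    obtain rfl : j = 0 := by omega
    simpa using lp.memℓp f
  | succ k ih =>
    simp only [powDomain, Submodule.mem_map, Submodule.mem_comap]
    constructor
    · rintro ⟨g, hg, rfl⟩ j hj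
      cases j with
      | zero => simpa using lp.memℓp (g : EllTwo I)
      | succ j =>
        refine (congrArg (Memℓp · 2) (funext fun i => ?_)).mp (ih.1 hg j (by omega))
        change (w i : ℂ) ^ j * ((w i : ℂ) * (g : EllTwo I) i) = _
        rw [pow_succ, mul_assoc]
        rfl
    · intro h
      have h1 : f ∈ (multOp w).domain := by
        have := h 1 (by omega)
        simpa [mem_multOp_domain] using this
      refine ⟨⟨f, h1⟩, ih.2 fun j hj => ?_, rfl⟩
      refine (congrArg (Memℓp · 2) (funext fun i => ?_)).mp (h (j + 1) (by omega))
      change _ = (w i : ℂ) ^ j * ((w i : ℂ) * f i)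
      rw [pow_succ, mul_assoc]

lemma mem_smoothDomain_multOp {w : I → ℝ} {f : EllTwo I} :
    f ∈ smoothDomain (multOp w) ↔ ∀ k : ℕ, Memℓp (fun i => (w i : ℂ) ^ k * f i) 2 := by
  simp only [smoothDomain, Submodule.mem_iInf, mem_powDomain_multOp]
  exact ⟨fun h k => h k k le_rfl, fun h k j _ => h j⟩

lemma smoothDomain_le_domain (w : I → ℝ) : smoothDomain (multOp w) ≤ (multOp w).domain := by
  intro f hf
  have := mem_smoothDomain_multOp.1 hf 1
  simpa [mem_multOp_domain] using this

variable [DecidableEq I]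

lemma dense_of_single_mem (D : Submodule ℂ (EllTwo I))
    (h : ∀ (i : I) (a : ℂ), lp.single 2 i a ∈ D) : Dense (D : Set (EllTwo I)) := by
  intro f
  have hf := lp.hasSum_single (E := fun _ : I => ℂ) (p := 2) (by simp) f
  exact mem_closure_of_tendsto hf (Filter.Eventually.of_forall fun s =>
    D.sum_mem fun i _ => h i _)

instance separableSpace_ellTwo [Countable I] : TopologicalSpace.SeparableSpace (EllTwo I) := by
  let S : Set (EllTwo I) := Set.range fun i : I => lp.single 2 i (1 : ℂ)
  have hS : TopologicalSpace.IsSeparable (Submodule.span ℂ S : Set (EllTwo I)) :=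
    (Set.countable_range _).isSeparable.span
  have hd : Dense (Submodule.span ℂ S : Set (EllTwo I)) := by
    refine dense_of_single_mem _ fun i a => ?_
    have : lp.single 2 i a = a • (lp.single 2 i (1 : ℂ) : EllTwo I) := by
      rw [← lp.single_smul]; simp
    rw [this]
    exact Submodule.smul_mem _ _ (Submodule.subset_span ⟨i, rfl⟩)
  rw [← TopologicalSpace.isSeparable_univ_iff, ← hd.closure_eq]
  exact hS.closure

lemma single_mem_smoothDomain (w : I → ℝ) (i : I) (a : ℂ) :
    lp.single 2 i a ∈ smoothDomain (multOp w) := by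
  rw [mem_smoothDomain_multOp]
  intro k
  refine (congrArg (Memℓp · 2) (funext fun j => ?_)).mp
    (lp.memℓp (lp.single 2 i ((w i : ℂ) ^ k * a) : EllTwo I))
  by_cases h : j = i
  · subst h; simp
  · simp [lp.single_apply, h]

lemma dense_smoothDomain (w : I → ℝ) : Dense (smoothDomain (multOp w) : Set (EllTwo I)) :=
  dense_of_single_mem _ fun i a => single_mem_smoothDomain w i a

lemma dense_multOp_domain (w : I → ℝ) : Dense ((multOp w).domain : Set (EllTwo I)) :=
  (dense_smoothDomain w).mono (smoothDomain_le_domain w)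

/-- The operator is symmetric because w is real. Conversely, pairing the adjoint at g with unit
vectors shows that it acts on g as multiplication by w; hence wg ∈ ℓ² and g lies in the domain. -/
lemma isSelfAdjoint_multOp (w : I → ℝ) : IsSelfAdjoint (multOp w) := by
  have hd := dense_multOp_domain w
  have hf : (multOp w).IsFormalAdjoint (multOp w) := by
    intro f g
    rw [lp.inner_eq_tsum, lp.inner_eq_tsum]
    refine tsum_congr fun i => ?_
    simp [multOp_apply]
    ring
  rw [LinearPMap.isSelfAdjoint_def]
  refine (LinearPMap.eq_of_le_of_domain_eq (hf.le_adjoint hd) (le_antisymm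
    (hf.le_adjoint hd).1 ?_)).symm
  intro g hg
  rw [mem_multOp_domain]
  refine (congrArg (Memℓp · 2) (funext fun i => ?_)).mp
    (lp.memℓp ((multOp w).adjoint ⟨g, hg⟩ : EllTwo I))
  have hi : lp.single 2 i (1 : ℂ) ∈ (multOp w).domain :=
    smoothDomain_le_domain w (single_mem_smoothDomain w i 1)
  have h := LinearPMap.adjoint_isFormalAdjoint hd ⟨g, hg⟩ ⟨_, hi⟩
  have h2 : multOp w ⟨_, hi⟩ = (lp.single 2 i (w i : ℂ) : EllTwo I) := by
    ext j
    rw [multOp_apply]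
    by_cases hj : j = i
    · subst hj; simp
    · simp [lp.single_apply, hj]
  rw [h2] at h
  simp only [lp.inner_single_right] at h
  have h3 := congrArg (starRingEnd ℂ) h
  simpa using h3

lemma isUnbounded_multOp (w : I → ℝ) (hw : ∀ c : ℝ, ∃ i, c < w i) : IsUnbounded (multOp w) := by
  rintro ⟨c, hc⟩
  obtain ⟨i, hi⟩ := hw c
  have hm : lp.single 2 i (1 : ℂ) ∈ (multOp w).domain :=
    smoothDomain_le_domain w (single_mem_smoothDomain w i 1)
  have h1 := hc ⟨_, hm⟩
  have h2 := lp.norm_apply_le_norm (p := 2) (by simp) (multOp w ⟨_, hm⟩ : EllTwo I) i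
  rw [multOp_apply] at h2
  simp [lp.norm_single] at h1 h2
  have := le_abs_self (w i)
  linarith

end Mult

/-! ### Rapidly decaying sequences and two pairs of ladder operators -/

/-- The weight `(n + 1) (m + 1)` on `ℕ × ℕ`. -/
def weight (i : ℕ × ℕ) : ℝ := ((i.1 : ℝ) + 1) * ((i.2 : ℝ) + 1)

lemma weight_pos (i : ℕ × ℕ) : 0 < weight i := by unfold weight; positivity

/-- The common domain of all powers of the multiplication by the weight. -/
abbrev decayDomain : Submodule ℂ (EllTwo (ℕ × ℕ)) := smoothDomain (multOp weight)

/-- The rapidly decaying families on `ℕ × ℕ`. -/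
def IsDecaying (f : ℕ × ℕ → ℂ) : Prop := ∀ k : ℕ, ∃ C : ℝ, ∀ i, weight i ^ k * ‖f i‖ ≤ C

lemma summable_weight_inv_sq : Summable fun i : ℕ × ℕ => (weight i ^ 2)⁻¹ := by
  have h : Summable fun n : ℕ => (((n : ℝ) + 1) ^ 2)⁻¹ := by
    have := (summable_nat_add_iff 1).2 (Real.summable_one_div_nat_pow.2 (one_lt_two))
    simpa using this
  have := h.mul_of_nonneg h (fun n => by positivity) (fun n => by positivity)
  refine this.congr fun i => ?_
  rw [weight, mul_pow, mul_inv]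

/-- One extra power of the weight suffices, since weight⁻² is summable. Supremum bounds thus
describe the smooth domain, and they are easier to follow through index shifts than ℓ² norms. -/
lemma IsDecaying.memℓp_pow {f : ℕ × ℕ → ℂ} (hf : IsDecaying f) (k : ℕ) :
    Memℓp (fun i => (weight i : ℂ) ^ k * f i) 2 := by
  obtain ⟨C, hC⟩ := hf (k + 1)
  refine memℓp_gen ?_
  refine Summable.of_nonneg_of_le (fun i => by positivity) (fun i => ?_)
    (summable_weight_inv_sq.mul_left (C ^ 2))
  have hw := weight_pos i
  have h := hC i
  simp only [ENNReal.toReal_ofNat, Real.rpow_ofNat, norm_mul, norm_pow, Complex.norm_real,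
    Real.norm_eq_abs, abs_of_pos hw]
  rw [← div_eq_mul_inv, le_div_iff₀ (by positivity), ← mul_pow]
  refine pow_le_pow_left₀ (by positivity) ?_ 2
  calc weight i ^ k * ‖f i‖ * weight i = weight i ^ (k + 1) * ‖f i‖ := by ring
    _ ≤ C := h

lemma isDecaying_of_mem {f : EllTwo (ℕ × ℕ)} (hf : f ∈ decayDomain) : IsDecaying f := by
  intro k
  let g : EllTwo (ℕ × ℕ) := ⟨_, mem_smoothDomain_multOp.1 hf k⟩
  refine ⟨‖g‖, fun i => ?_⟩
  have h := lp.norm_apply_le_norm (p := 2) (by simp) g i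
  have hg : g i = (weight i : ℂ) ^ k * f i := rfl
  rw [hg] at h
  simpa [abs_of_pos (weight_pos i)] using h

/-- A rapidly decaying family as an element of the domain. -/
def IsDecaying.toDomain {f : ℕ × ℕ → ℂ} (hf : IsDecaying f) : decayDomain :=
  ⟨⟨f, by have := hf.memℓp_pow 0; simp only [pow_zero, one_mul] at this; exact this⟩,
    mem_smoothDomain_multOp.2 hf.memℓp_pow⟩

/-- The values of an element of the domain. -/
def decayVal : decayDomain →ₗ[ℂ] (ℕ × ℕ → ℂ) where
  toFun f := (f : EllTwo (ℕ × ℕ))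
  map_add' _ _ := rfl
  map_smul' _ _ := rfl

lemma decayVal_injective : Function.Injective decayVal := fun _ _ h =>
  Subtype.ext (Subtype.ext h)

lemma isDecaying_decayVal (f : decayDomain) : IsDecaying (decayVal f) := isDecaying_of_mem f.2

@[simp] lemma decayVal_toDomain {f : ℕ × ℕ → ℂ} (hf : IsDecaying f) :
    decayVal hf.toDomain = f := rfl

lemma inner_decay (f g : decayDomain) :
    inner ℂ (f : EllTwo (ℕ × ℕ)) (g : EllTwo (ℕ × ℕ)) =
      ∑' i, starRingEnd ℂ (decayVal f i) * decayVal g i := by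
  rw [lp.inner_eq_tsum]
  refine tsum_congr fun i => ?_
  rw [RCLike.inner_apply, mul_comm]
  rfl

/-- Operators that preserve rapid decay. -/
def PreservesDecay (T : (ℕ × ℕ → ℂ) →ₗ[ℂ] (ℕ × ℕ → ℂ)) : Prop :=
  ∀ f, IsDecaying f → IsDecaying (T f)

/-- An operator that preserves rapid decay, as an operator on the domain. -/
def PreservesDecay.toEnd {T : (ℕ × ℕ → ℂ) →ₗ[ℂ] (ℕ × ℕ → ℂ)} (hT : PreservesDecay T) :
    Module.End ℂ decayDomain where
  toFun f := (hT _ (isDecaying_decayVal f)).toDomain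
  map_add' f g := decayVal_injective (by simp)
  map_smul' c f := decayVal_injective (by simp)

@[simp] lemma PreservesDecay.decayVal_toEnd {T : (ℕ × ℕ → ℂ) →ₗ[ℂ] (ℕ × ℕ → ℂ)}
    (hT : PreservesDecay T) (f : decayDomain) : decayVal (hT.toEnd f) = T (decayVal f) := rfl

/-- The exchange of the two factors of `ℕ × ℕ`. -/
def swapMap : (ℕ × ℕ → ℂ) →ₗ[ℂ] (ℕ × ℕ → ℂ) := LinearMap.funLeft ℂ ℂ Prod.swap

/-- The lowering operator of the first factor. -/
def lowerFst : (ℕ × ℕ → ℂ) →ₗ[ℂ] (ℕ × ℕ → ℂ) where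
  toFun f i := (Real.sqrt (i.1 + 1) : ℂ) * f (i.1 + 1, i.2)
  map_add' f g := by ext i; simp [mul_add]
  map_smul' c f := by ext i; simp [mul_left_comm]

/-- The raising operator of the first factor. -/
def raiseFst : (ℕ × ℕ → ℂ) →ₗ[ℂ] (ℕ × ℕ → ℂ) where
  -- At `i.1 = 0` the truncated predecessor is harmless, because the factor √0 vanishes.
  toFun f i := (Real.sqrt i.1 : ℂ) * f (i.1 - 1, i.2)
  map_add' f g := by ext i; simp [mul_add]
  map_smul' c f := by ext i; simp [mul_left_comm]

/-- The lowering operator of the second factor. -/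
def lowerSnd : (ℕ × ℕ → ℂ) →ₗ[ℂ] (ℕ × ℕ → ℂ) := swapMap ∘ₗ lowerFst ∘ₗ swapMap

/-- The raising operator of the second factor. -/
def raiseSnd : (ℕ × ℕ → ℂ) →ₗ[ℂ] (ℕ × ℕ → ℂ) := swapMap ∘ₗ raiseFst ∘ₗ swapMap

/-- Multiplication by a function of the second variable. -/
def diagSnd (y : ℕ → ℂ) : (ℕ × ℕ → ℂ) →ₗ[ℂ] (ℕ × ℕ → ℂ) where
  toFun f i := y i.2 * f i
  map_add' f g := by ext i; simp [mul_add]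
  map_smul' c f := by ext i; simp [mul_left_comm]

lemma lowerFst_apply (f : ℕ × ℕ → ℂ) (n m : ℕ) :
    lowerFst f (n, m) = (Real.sqrt (n + 1) : ℂ) * f (n + 1, m) := rfl

lemma raiseFst_zero (f : ℕ × ℕ → ℂ) (m : ℕ) : raiseFst f (0, m) = 0 := by
  simp [raiseFst]

lemma raiseFst_succ (f : ℕ × ℕ → ℂ) (n m : ℕ) :
    raiseFst f (n + 1, m) = (Real.sqrt (n + 1) : ℂ) * f (n, m) := by
  simp [raiseFst]

lemma lowerSnd_apply (f : ℕ × ℕ → ℂ) (n m : ℕ) :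
    lowerSnd f (n, m) = (Real.sqrt (m + 1) : ℂ) * f (n, m + 1) := rfl

lemma raiseSnd_zero (f : ℕ × ℕ → ℂ) (n : ℕ) : raiseSnd f (n, 0) = 0 :=
  raiseFst_zero _ _

lemma raiseSnd_succ (f : ℕ × ℕ → ℂ) (n m : ℕ) :
    raiseSnd f (n, m + 1) = (Real.sqrt (m + 1) : ℂ) * f (n, m) :=
  raiseFst_succ _ _ _

lemma diagSnd_apply (y : ℕ → ℂ) (f : ℕ × ℕ → ℂ) (n m : ℕ) : diagSnd y f (n, m) = y m * f (n, m) :=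
  rfl

lemma sqrt_mul_sqrt_succ (n : ℕ) :
    (Real.sqrt (n + 1) : ℂ) * (Real.sqrt (n + 1) : ℂ) = (n : ℂ) + 1 := by
  rw [← Complex.ofReal_mul, Real.mul_self_sqrt (by positivity)]
  simp

lemma sqrt_succ_le_weight (n m : ℕ) : Real.sqrt ((n : ℝ) + 1) ≤ weight (n, m) := by
  have h1 : Real.sqrt ((n : ℝ) + 1) ≤ (n : ℝ) + 1 := by
    rw [Real.sqrt_le_left (by positivity)]
    nlinarith [(Nat.cast_nonneg n : (0 : ℝ) ≤ n)]
  have h2 : (n : ℝ) + 1 ≤ ((n : ℝ) + 1) * ((m : ℝ) + 1) :=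
    le_mul_of_one_le_right (by positivity) (by simp)
  exact h1.trans h2

lemma weight_le_weight_succ (n m : ℕ) : weight (n, m) ≤ weight (n + 1, m) := by
  unfold weight; push_cast
  gcongr
  simp

lemma weight_succ_le (n m : ℕ) : weight (n + 1, m) ≤ 2 * weight (n, m) := by
  unfold weight; push_cast
  rw [← mul_assoc]
  gcongr
  linarith [(Nat.cast_nonneg n : (0 : ℝ) ≤ n)]

lemma preservesDecay_swapMap : PreservesDecay swapMap := by
  intro f hf k
  obtain ⟨C, hC⟩ := hf k
  refine ⟨C, fun i => ?_⟩
  have h := hC i.swap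
  have hw : weight i.swap = weight i := by simp [weight, mul_comm]
  rwa [hw] at h

/-- The square root costs one power of the weight, and evaluating f at a larger index only helps. -/
lemma preservesDecay_lowerFst : PreservesDecay lowerFst := by
  intro f hf k
  obtain ⟨C, hC⟩ := hf (k + 1)
  refine ⟨C, fun ⟨n, m⟩ => ?_⟩
  have h0 := weight_pos (n, m)
  have h1 := weight_le_weight_succ n m
  have h2 := (sqrt_succ_le_weight n m).trans h1
  have h3 := weight_pos (n + 1, m)
  rw [lowerFst_apply, norm_mul, Complex.norm_real, Real.norm_eq_abs,
    abs_of_nonneg (Real.sqrt_nonneg _), ← mul_assoc]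
  refine le_trans ?_ (hC (n + 1, m))
  rw [pow_succ]
  gcongr

/-- The square root again costs one power of the weight. The shift at most doubles the weight,
whence the factor 2ᵏ. -/
lemma preservesDecay_raiseFst : PreservesDecay raiseFst := by
  intro f hf k
  obtain ⟨C, hC⟩ := hf (k + 1)
  have hC0 : 0 ≤ C := le_trans (by have := weight_pos (0, 0); positivity) (hC (0, 0))
  refine ⟨2 ^ k * C, fun ⟨n, m⟩ => ?_⟩
  cases n with
  | zero => rw [raiseFst_zero, norm_zero, mul_zero]; positivity
  | succ n =>
    have h0 := weight_pos (n, m)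
    have h3 := weight_pos (n + 1, m)
    have h1 := weight_succ_le n m
    have h2 := sqrt_succ_le_weight n m
    rw [raiseFst_succ, norm_mul, Complex.norm_real, Real.norm_eq_abs,
      abs_of_nonneg (Real.sqrt_nonneg _)]
    calc weight (n + 1, m) ^ k * (Real.sqrt (n + 1) * ‖f (n, m)‖)
        ≤ (2 * weight (n, m)) ^ k * (weight (n, m) * ‖f (n, m)‖) := by gcongr
      _ = 2 ^ k * (weight (n, m) ^ (k + 1) * ‖f (n, m)‖) := by ring
      _ ≤ 2 ^ k * C := by gcongr; exact hC (n, m)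

lemma preservesDecay_lowerSnd : PreservesDecay lowerSnd := fun f hf =>
  preservesDecay_swapMap _ (preservesDecay_lowerFst _ (preservesDecay_swapMap f hf))

lemma preservesDecay_raiseSnd : PreservesDecay raiseSnd := fun f hf =>
  preservesDecay_swapMap _ (preservesDecay_raiseFst _ (preservesDecay_swapMap f hf))

lemma preservesDecay_diagSnd {y : ℕ → ℂ} (hy : ∀ m, ‖y m‖ ≤ 1) : PreservesDecay (diagSnd y) := by
  intro f hf k
  obtain ⟨C, hC⟩ := hf k
  refine ⟨C, fun ⟨n, m⟩ => le_trans ?_ (hC (n, m))⟩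
  have h0 := weight_pos (n, m)
  rw [diagSnd_apply, norm_mul]
  gcongr
  exact mul_le_of_le_one_left (norm_nonneg _) (hy m)

/-- Reindexing by n ↦ n + 1: the terms with n = 0 on the right vanish, so the injection carries one
sum to the other without any convergence argument. -/
lemma tsum_lowerFst (f g : ℕ × ℕ → ℂ) :
    ∑' i, starRingEnd ℂ (lowerFst f i) * g i = ∑' i, starRingEnd ℂ (f i) * raiseFst g i := by
  have hinj : Function.Injective fun i : ℕ × ℕ => (i.1 + 1, i.2) := by
    rintro ⟨a, b⟩ ⟨c, d⟩ h
    simpa using h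
  rw [← hinj.tsum_eq (f := fun i => starRingEnd ℂ (f i) * raiseFst g i)]
  · refine tsum_congr fun ⟨n, m⟩ => ?_
    rw [lowerFst_apply, raiseFst_succ, map_mul, Complex.conj_ofReal]
    ring
  · rintro ⟨n, m⟩ h
    cases n with
    | zero => simp [raiseFst_zero] at h
    | succ n => exact ⟨(n, m), rfl⟩

lemma tsum_lowerSnd (f g : ℕ × ℕ → ℂ) :
    ∑' i, starRingEnd ℂ (lowerSnd f i) * g i = ∑' i, starRingEnd ℂ (f i) * raiseSnd g i := by
  have h := tsum_lowerFst (swapMap f) (swapMap g)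
  rw [← (Equiv.prodComm ℕ ℕ).tsum_eq, ← (Equiv.prodComm ℕ ℕ).tsum_eq
    fun i => starRingEnd ℂ (f i) * raiseSnd g i]
  exact h

lemma isDagger_lowerFst : IsDagger preservesDecay_lowerFst.toEnd preservesDecay_raiseFst.toEnd :=
  fun f g => by rw [inner_decay, inner_decay]; exact tsum_lowerFst _ _

lemma isDagger_lowerSnd : IsDagger preservesDecay_lowerSnd.toEnd preservesDecay_raiseSnd.toEnd :=
  fun f g => by rw [inner_decay, inner_decay]; exact tsum_lowerSnd _ _

lemma isDagger_diagSnd {y z : ℕ → ℂ} (hy : ∀ m, ‖y m‖ ≤ 1) (hz : ∀ m, ‖z m‖ ≤ 1)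
    (h : ∀ m, z m = starRingEnd ℂ (y m)) :
    IsDagger (preservesDecay_diagSnd hy).toEnd (preservesDecay_diagSnd hz).toEnd := by
  intro f g
  rw [inner_decay, inner_decay]
  refine tsum_congr fun ⟨n, m⟩ => ?_
  simp only [PreservesDecay.decayVal_toEnd, diagSnd_apply, h, map_mul]
  ring

/-- The algebra `𝓛†` of the rapidly decaying families. -/
abbrev DecayOps : Type := LDagger decayDomain

instance : LieRing DecayOps := LieRing.ofAssociativeRing

instance : LieAlgebra ℂ DecayOps := LieAlgebra.ofAssociativeAlgebra

/-- The values `0, 1, i, 0, 0, …` of a bounded normal operator on the second factor. -/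
def shiftVal (m : ℕ) : ℂ := if m = 1 then 1 else if m = 2 then Complex.I else 0

lemma norm_shiftVal_le (m : ℕ) : ‖shiftVal m‖ ≤ 1 := by
  unfold shiftVal; split_ifs <;> simp

lemma norm_conj_shiftVal_le (m : ℕ) : ‖starRingEnd ℂ (shiftVal m)‖ ≤ 1 := by
  rw [RCLike.norm_conj]; exact norm_shiftVal_le m

/-- Lowering on the first factor, in `𝓛†`. -/
def opL₁ : DecayOps := ⟨preservesDecay_lowerFst.toEnd, _, isDagger_lowerFst⟩

/-- Raising on the first factor, in `𝓛†`. -/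
def opR₁ : DecayOps := ⟨preservesDecay_raiseFst.toEnd, _, isDagger_lowerFst.symm⟩

/-- Lowering on the second factor, in `𝓛†`. -/
def opL₂ : DecayOps := ⟨preservesDecay_lowerSnd.toEnd, _, isDagger_lowerSnd⟩

/-- Raising on the second factor, in `𝓛†`. -/
def opR₂ : DecayOps := ⟨preservesDecay_raiseSnd.toEnd, _, isDagger_lowerSnd.symm⟩

lemma isDagger_shift : IsDagger (preservesDecay_diagSnd norm_shiftVal_le).toEnd
    (preservesDecay_diagSnd norm_conj_shiftVal_le).toEnd :=
  isDagger_diagSnd norm_shiftVal_le norm_conj_shiftVal_le fun _ => rfl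

/-- The bounded normal operator on the second factor, in `𝓛†`. -/
def opY : DecayOps := ⟨(preservesDecay_diagSnd norm_shiftVal_le).toEnd, _, isDagger_shift⟩

/-- The adjoint of `opY`. -/
def opYdag : DecayOps :=
  ⟨(preservesDecay_diagSnd norm_conj_shiftVal_le).toEnd, _, isDagger_shift.symm⟩

/-- The values of the image of an element of the domain under an element of `𝓛†`. -/
def act : DecayOps →ₗ[ℂ] decayDomain →ₗ[ℂ] (ℕ × ℕ → ℂ) where
  toFun X := decayVal ∘ₗ X.1
  map_add' _ _ := rfl
  map_smul' _ _ := rfl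

lemma decayOps_ext {X Y : DecayOps} (h : ∀ f n m, act X f (n, m) = act Y f (n, m)) : X = Y :=
  Subtype.ext (LinearMap.ext fun f => decayVal_injective (funext fun ⟨n, m⟩ => h f n m))

lemma act_lie (X Y : DecayOps) (f : decayDomain) :
    act ⁅X, Y⁆ f = act X (Y.1 f) - act Y (X.1 f) := by
  rw [Ring.lie_def]; rfl

@[simp] lemma act_one (f : decayDomain) : act 1 f = decayVal f := rfl
@[simp] lemma act_opL₁ (f : decayDomain) : act opL₁ f = lowerFst (decayVal f) := rfl
@[simp] lemma act_opR₁ (f : decayDomain) : act opR₁ f = raiseFst (decayVal f) := rfl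
@[simp] lemma act_opL₂ (f : decayDomain) : act opL₂ f = lowerSnd (decayVal f) := rfl
@[simp] lemma act_opR₂ (f : decayDomain) : act opR₂ f = raiseSnd (decayVal f) := rfl
@[simp] lemma act_opY (f : decayDomain) : act opY f = diagSnd shiftVal (decayVal f) := rfl
@[simp] lemma act_opYdag (f : decayDomain) :
    act opYdag f = diagSnd (fun m => starRingEnd ℂ (shiftVal m)) (decayVal f) := rfl
@[simp] lemma decayVal_opL₁ (f : decayDomain) : decayVal (opL₁.1 f) = lowerFst (decayVal f) := rfl
@[simp] lemma decayVal_opR₁ (f : decayDomain) : decayVal (opR₁.1 f) = raiseFst (decayVal f) := rfl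
@[simp] lemma decayVal_opL₂ (f : decayDomain) : decayVal (opL₂.1 f) = lowerSnd (decayVal f) := rfl
@[simp] lemma decayVal_opR₂ (f : decayDomain) : decayVal (opR₂.1 f) = raiseSnd (decayVal f) := rfl
@[simp] lemma decayVal_opY (f : decayDomain) :
    decayVal (opY.1 f) = diagSnd shiftVal (decayVal f) := rfl
@[simp] lemma decayVal_opYdag (f : decayDomain) :
    decayVal (opYdag.1 f) = diagSnd (fun m => starRingEnd ℂ (shiftVal m)) (decayVal f) := rfl

/-! ### Commutation relations of the ladder and diagonal operators. -/

lemma lie_L₁_R₁ : ⁅opL₁, opR₁⁆ = 1 := by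
  refine decayOps_ext fun f n m => ?_
  have h1 := sqrt_mul_sqrt_succ n
  cases n with
  | zero => simp [act_lie, raiseFst_zero, lowerFst_apply, raiseFst_succ]
  | succ n =>
    have h2 := sqrt_mul_sqrt_succ n
    simp only [act_lie, Pi.sub_apply, act_opL₁, act_opR₁, decayVal_opL₁, decayVal_opR₁,
      lowerFst_apply, raiseFst_succ, act_one]
    linear_combination (decayVal f (n + 1, m)) * (h1 - h2) + (decayVal f (n + 1, m)) *
      (by push_cast; ring : ((n + 1 : ℕ) : ℂ) + 1 - ((n : ℂ) + 1) = 1)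

lemma lie_L₂_R₂ : ⁅opL₂, opR₂⁆ = 1 := by
  refine decayOps_ext fun f n m => ?_
  have h1 := sqrt_mul_sqrt_succ m
  cases m with
  | zero => simp [act_lie, raiseSnd_zero, lowerSnd_apply, raiseSnd_succ]
  | succ m =>
    have h2 := sqrt_mul_sqrt_succ m
    simp only [act_lie, Pi.sub_apply, act_opL₂, act_opR₂, decayVal_opL₂, decayVal_opR₂,
      lowerSnd_apply, raiseSnd_succ, act_one]
    linear_combination (decayVal f (n, m + 1)) * (h1 - h2) + (decayVal f (n, m + 1)) *
      (by push_cast; ring : ((m + 1 : ℕ) : ℂ) + 1 - ((m : ℂ) + 1) = 1)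

lemma lie_L₁_L₂ : ⁅opL₁, opL₂⁆ = 0 := by
  refine decayOps_ext fun f n m => ?_
  simp [act_lie, lowerFst_apply, lowerSnd_apply]
  ring

lemma lie_L₁_R₂ : ⁅opL₁, opR₂⁆ = 0 := by
  refine decayOps_ext fun f n m => ?_
  cases m <;> simp [act_lie, lowerFst_apply, raiseSnd_zero, raiseSnd_succ]
  ring

lemma lie_L₂_R₁ : ⁅opL₂, opR₁⁆ = 0 := by
  refine decayOps_ext fun f n m => ?_
  cases n <;> simp [act_lie, lowerSnd_apply, raiseFst_zero, raiseFst_succ]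
  ring

lemma lie_R₂_R₁ : ⁅opR₂, opR₁⁆ = 0 := by
  refine decayOps_ext fun f n m => ?_
  cases n <;> cases m <;>
    simp [act_lie, raiseSnd_zero, raiseSnd_succ, raiseFst_zero, raiseFst_succ]
  ring

lemma lie_L₁_Y : ⁅opL₁, opY⁆ = 0 := by
  refine decayOps_ext fun f n m => ?_
  simp [act_lie, lowerFst_apply, diagSnd_apply]
  ring

lemma lie_L₁_Ydag : ⁅opL₁, opYdag⁆ = 0 := by
  refine decayOps_ext fun f n m => ?_
  simp [act_lie, lowerFst_apply, diagSnd_apply]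
  ring

lemma lie_R₁_Y : ⁅opR₁, opY⁆ = 0 := by
  refine decayOps_ext fun f n m => ?_
  cases n <;> simp [act_lie, raiseFst_zero, raiseFst_succ, diagSnd_apply]
  ring

lemma lie_R₁_Ydag : ⁅opR₁, opYdag⁆ = 0 := by
  refine decayOps_ext fun f n m => ?_
  cases n <;> simp [act_lie, raiseFst_zero, raiseFst_succ, diagSnd_apply]
  ring

lemma lie_Y_Ydag : ⁅opY, opYdag⁆ = 0 := by
  refine decayOps_ext fun f n m => ?_
  simp [act_lie, diagSnd_apply]
  ring

lemma decayOps_lie_one (X : DecayOps) : ⁅X, (1 : DecayOps)⁆ = 0 := by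
  rw [Ring.lie_def, mul_one, one_mul, sub_self]

/-- The unit vector at `i`. -/
def unitVec (i : ℕ × ℕ) : decayDomain :=
  ⟨lp.single 2 i 1, single_mem_smoothDomain weight i 1⟩

lemma decayVal_unitVec (i j : ℕ × ℕ) : decayVal (unitVec i) j = if j = i then 1 else 0 := by
  change (lp.single 2 i (1 : ℂ) : EllTwo (ℕ × ℕ)) j = _
  rw [lp.single_apply]
  split_ifs with h
  · subst h; simp
  · simp [h]

lemma unitVec_ne_zero (i : ℕ × ℕ) : unitVec i ≠ 0 := by
  intro h
  have := congrFun (congrArg decayVal h) i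
  rw [decayVal_unitVec] at this
  simp at this

/-- Off-diagonal entries isolate r and s. On the diagonal, t + p ȳ + q y must vanish at y = 0, 1, i;
these points lie on no real line, so t = p = q = 0. -/
lemma eq_zero_of_shift_combination {r s t p q : ℂ}
    (h : r • opL₁ + s • opR₁ + t • (1 : DecayOps) + p • opYdag + q • opY = 0) :
    r = 0 ∧ s = 0 ∧ t = 0 ∧ p = 0 ∧ q = 0 := by
  have key : ∀ i n m, act (r • opL₁ + s • opR₁ + t • (1 : DecayOps) + p • opYdag + q • opY)
      (unitVec i) (n, m) = 0 := by
    intro i n m; rw [h]; simp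
  simp only [map_add, map_smul, LinearMap.add_apply, LinearMap.smul_apply,
    Pi.add_apply, Pi.smul_apply, smul_eq_mul] at key
  have h1 := key (0, 0) (0 + 1) 0
  have h2 := key (0, 0) 0 0
  have h0 := key (1, 0) 0 0
  have h3 := key (0, 1) 0 1
  have h4 := key (0, 2) 0 2
  simp [raiseFst_succ, raiseFst_zero, lowerFst_apply, diagSnd_apply, decayVal_unitVec,
    shiftVal] at h0 h1 h2 h3 h4
  subst h0 h1 h2
  have h5 : q = -p := by linear_combination h3
  subst h5
  have h6 : p = 0 := by
    have : p * Complex.I = 0 := by linear_combination (-1 / 2) * h4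
    simpa using this
  simp [h6]

lemma eq_zero_of_twoMode_combination {r s t p q : ℂ}
    (h : r • opL₁ + s • opR₁ + t • (1 : DecayOps) + p • opL₂ + q • opR₂ = 0) :
    r = 0 ∧ s = 0 ∧ t = 0 ∧ p = 0 ∧ q = 0 := by
  have key : ∀ i n m, act (r • opL₁ + s • opR₁ + t • (1 : DecayOps) + p • opL₂ + q • opR₂)
      (unitVec i) (n, m) = 0 := by
    intro i n m; rw [h]; simp
  simp only [map_add, map_smul, LinearMap.add_apply, LinearMap.smul_apply,
    Pi.add_apply, Pi.smul_apply, smul_eq_mul] at key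
  have h1 := key (0, 0) (0 + 1) 0
  have h2 := key (0, 0) 0 0
  have h0 := key (1, 0) 0 0
  have h3 := key (0, 1) 0 0
  have h4 := key (0, 0) 0 (0 + 1)
  simp [raiseFst_succ, raiseFst_zero, lowerFst_apply, raiseSnd_succ, raiseSnd_zero, lowerSnd_apply,
    decayVal_unitVec] at h0 h1 h2 h3 h4
  exact ⟨h0, h1, h2, h3, h4⟩

/-- The pair `A = L₁`, `B = R₁ + Y`. -/
def shiftPair : PseudobosonicPair decayDomain where
  A := opL₁.1
  B := (opR₁ + opY : DecayOps).1
  Adag := opR₁.1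
  Bdag := (opL₁ + opYdag : DecayOps).1
  isDagger_A := isDagger_lowerFst
  isDagger_B := fun f g => by
    have h1 := isDagger_lowerFst.symm f g
    have h2 := isDagger_shift f g
    change inner ℂ (opR₁.1 f + opY.1 f : EllTwo (ℕ × ℕ)) _ =
      inner ℂ _ (opL₁.1 g + opYdag.1 g : EllTwo (ℕ × ℕ))
    rw [inner_add_left, inner_add_right]
    exact congrArg₂ (· + ·) h1 h2
  ccr := fun f => by
    have h : ⁅opL₁, opR₁ + opY⁆ = 1 := by rw [lie_add, lie_L₁_R₁, lie_L₁_Y, add_zero]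
    exact LinearMap.congr_fun (congrArg Subtype.val h) f

/-- The pair `A = L₁`, `B = R₁ + R₂`. -/
def twoModePair : PseudobosonicPair decayDomain where
  A := opL₁.1
  B := (opR₁ + opR₂ : DecayOps).1
  Adag := opR₁.1
  Bdag := (opL₁ + opL₂ : DecayOps).1
  isDagger_A := isDagger_lowerFst
  isDagger_B := fun f g => by
    have h1 := isDagger_lowerFst.symm f g
    have h2 := isDagger_lowerSnd.symm f g
    change inner ℂ (opR₁.1 f + opR₂.1 f : EllTwo (ℕ × ℕ)) _ =
      inner ℂ _ (opL₁.1 g + opL₂.1 g : EllTwo (ℕ × ℕ))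
    rw [inner_add_left, inner_add_right]
    exact congrArg₂ (· + ·) h1 h2
  ccr := fun f => by
    have h : ⁅opL₁, opR₁ + opR₂⁆ = 1 := by rw [lie_add, lie_L₁_R₁, lie_L₁_R₂, add_zero]
    exact LinearMap.congr_fun (congrArg Subtype.val h) f

lemma decayVal_unitVec_zero_succ (n m : ℕ) : decayVal (unitVec (0, 0)) (n + 1, m) = 0 := by
  simp [decayVal_unitVec]

lemma decayVal_unitVec_zero_succ' (n m : ℕ) : decayVal (unitVec (0, 0)) (n, m + 1) = 0 := by
  simp [decayVal_unitVec]

lemma lowerFst_unitVec : lowerFst (decayVal (unitVec (0, 0))) = 0 :=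
  funext fun ⟨n, m⟩ => by simp [lowerFst_apply, decayVal_unitVec_zero_succ]

lemma lowerSnd_unitVec : lowerSnd (decayVal (unitVec (0, 0))) = 0 :=
  funext fun ⟨n, m⟩ => by simp [lowerSnd_apply, decayVal_unitVec_zero_succ']

lemma diagSnd_unitVec : diagSnd (fun m => starRingEnd ℂ (shiftVal m))
    (decayVal (unitVec (0, 0))) = 0 := by
  ext ⟨n, m⟩
  cases m with
  | zero => simp [diagSnd_apply, shiftVal]
  | succ m => simp [diagSnd_apply, decayVal_unitVec_zero_succ']

lemma shiftPair_hasVacua : shiftPair.HasVacua := by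
  refine ⟨⟨unitVec (0, 0), unitVec_ne_zero _, decayVal_injective ?_⟩,
    ⟨unitVec (0, 0), unitVec_ne_zero _, decayVal_injective ?_⟩⟩
  · rw [map_zero]; exact lowerFst_unitVec
  · rw [map_zero]
    exact (congrArg₂ (· + ·) lowerFst_unitVec diagSnd_unitVec).trans (add_zero _)

lemma twoModePair_hasVacua : twoModePair.HasVacua := by
  refine ⟨⟨unitVec (0, 0), unitVec_ne_zero _, decayVal_injective ?_⟩,
    ⟨unitVec (0, 0), unitVec_ne_zero _, decayVal_injective ?_⟩⟩
  · rw [map_zero]; exact lowerFst_unitVec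
  · rw [map_zero]
    exact (congrArg₂ (· + ·) lowerFst_unitVec lowerSnd_unitVec).trans (add_zero _)

/-! ### Standard realizations of the Heisenberg types. -/

section Realization

variable {𝔤 : Type*} [LieRing 𝔤] [LieAlgebra ℂ 𝔤]

lemma isRealizedStandard_of_realizes {P : PseudobosonicPair decayDomain} (hv : P.HasVacua)
    (h : P.Realizes 𝔤) : IsRealizedStandard 𝔤 := by
  refine ⟨EllTwo (ℕ × ℕ), inferInstance, inferInstance, inferInstance, inferInstance,
    multOp weight, P, dense_multOp_domain _, isSelfAdjoint_multOp _, isUnbounded_multOp _ ?_,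
    dense_smoothDomain _, hv, h⟩
  intro c
  obtain ⟨n, hn⟩ := exists_nat_gt c
  exact ⟨(n, 0), by simp [weight]; linarith⟩

/-- The table is checked on a convenient basis T of the span of S, which need not consist of the
operators A, B, B†, A†, 𝕀 themselves. -/
lemma realizes_of_family {P : PseudobosonicPair decayDomain} {n : ℕ} {a b c d : ℂ}
    (hg : HasFlagForm n 𝔤 a b c d) (T : Fin n → DecayOps)
    (hT : ∀ g : Fin n → ℂ, ∑ i, g i • T i = 0 → g = 0)
    (hl : ∀ s t : Fin n → ℂ, ⁅∑ i, s i • T i, ∑ i, t i • T i⁆ = ∑ i, flagFun n a b c d s t i • T i)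
    (S : Set DecayOps) (hS : S ⊆ insert 1 (Set.range P.op))
    (h3 : 3 ≤ n → P.op 0 ∈ S ∧ P.op 1 ∈ S)
    (h1 : ∀ i, T i ∈ Submodule.span ℂ S) (h2 : ∀ X ∈ S, X ∈ Submodule.span ℂ (Set.range T)) :
    P.Realizes 𝔤 := by
  obtain ⟨e, he⟩ := hg
  have hn : Module.finrank ℂ 𝔤 = n := by rw [e.finrank_eq]; simp
  refine ⟨S, hS, by rwa [hn], Fintype.linearCombination ℂ T ∘ₗ e.toLinearMap, fun x y => ?_, ?_, ?_⟩
  · simp only [LinearMap.comp_apply, LinearEquiv.coe_coe, he, Fintype.linearCombination_apply]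
    exact (hl (e x) (e y)).symm
  · rw [injective_iff_map_eq_zero]
    intro x hx
    simp only [LinearMap.comp_apply, LinearEquiv.coe_coe, Fintype.linearCombination_apply] at hx
    simpa using hT _ hx
  · rw [LinearMap.range_comp_of_range_eq_top _ (LinearEquiv.range e),
      Fintype.range_linearCombination]
    refine le_antisymm (Submodule.span_le.2 ?_) (Submodule.span_le.2 h2)
    rintro _ ⟨i, rfl⟩
    exact h1 i

/-- Besides A, B, 𝕀 the span contains Y† = B† − A and −Y = A† − B. Y is normal and acts on the
second factor only, so both differences commute with A and B. -/
lemma shiftPair_lie : ⁅opL₁, opR₁ + opY⁆ = (1 : ℂ) • (1 : DecayOps) ∧ ⁅opL₁, opYdag⁆ = 0 ∧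
    ⁅opL₁, -opY⁆ = 0 ∧ ⁅opR₁ + opY, opYdag⁆ = 0 ∧ ⁅opR₁ + opY, -opY⁆ = 0 := by
  simp [lie_L₁_R₁, lie_L₁_Y, lie_L₁_Ydag, lie_R₁_Ydag, lie_Y_Ydag, lie_R₁_Y]

/-- The members `[e₀,e₁] = e₂` of the family are realized in every dimension at most five. -/
theorem isRealizedStandard_of_heisenberg {n : ℕ} (h5 : n ≤ 5) (hg : HasFlagForm n 𝔤 1 0 0 0) :
    IsRealizedStandard 𝔤 := by
  refine isRealizedStandard_of_realizes shiftPair_hasVacua ?_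
  obtain ⟨hAB, hAY', hAY, hBY', hBY⟩ := shiftPair_lie
  have h1 : ∀ X : DecayOps, ⁅(1 : DecayOps), X⁆ = 0 := fun X => by
    rw [← lie_skew, decayOps_lie_one, neg_zero]
  have h2 := decayOps_lie_one
  have h0 : n = 0 ∨ n = 1 ∨ n = 2 ∨ n = 3 ∨ n = 4 ∨ n = 5 := by omega
  -- The spanning sets are ∅, {𝕀}, {A, 𝕀}, {A, B, 𝕀}, then B† is added, then A†. In the table 𝕀 =
  -- [A,B] takes the place of e₂.
  rcases h0 with rfl | rfl | rfl | rfl | rfl | rfl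
  · exact realizes_of_family hg Fin.elim0 (fun g _ => Subsingleton.elim _ _) (fun s t => by simp)
      ∅ (Set.empty_subset _) (by omega) (fun i => i.elim0) (by simp)
  · refine realizes_of_family hg ![1] (fun g h => ?_) (fun s t => by simp [flagFun, h2])
      {1} (by simp) (by omega) (fun i => ?_) (fun X hX => ?_)
    · have := eq_zero_of_shift_combination (r := 0) (s := 0) (t := g 0) (p := 0) (q := 0)
        (by rw [← h, Fin.sum_univ_one]; simp only [zero_smul, zero_add, add_zero]; rfl)
      ext i; fin_cases i; exact this.2.2.1
    · fin_cases i; exact Submodule.subset_span rfl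
    · exact Submodule.subset_span ⟨0, by simpa using hX.symm⟩
  · refine realizes_of_family hg ![opL₁, 1] (fun g h => ?_) (fun s t => by simp [flagFun, h1, h2])
      {opL₁, 1} ?_ (by omega) (fun i => ?_) (fun X hX => ?_)
    · have := eq_zero_of_shift_combination (r := g 0) (s := 0) (t := g 1) (p := 0) (q := 0)
        (by simpa using h)
      ext i; fin_cases i
      exacts [this.1, this.2.2.1]
    · rintro _ (rfl | rfl)
      exacts [Or.inr ⟨0, rfl⟩, Or.inl rfl]
    · fin_cases i
      exacts [Submodule.subset_span (Or.inl rfl), Submodule.subset_span (Or.inr rfl)]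
    · rcases hX with rfl | rfl
      exacts [Submodule.subset_span ⟨0, rfl⟩, Submodule.subset_span ⟨1, rfl⟩]
  · refine realizes_of_family hg ![opL₁, opR₁ + opY, 1] (fun g h => ?_)
      (lie_sum_three hAB (h2 _) (h2 _) 0 0 0)
      {opL₁, opR₁ + opY, 1} ?_ (fun _ => ⟨Or.inl rfl, Or.inr (Or.inl rfl)⟩) (fun i => ?_)
      (fun X hX => ?_)
    -- The summand Y of B = R₁ + Y forces the coefficient of Y to equal that of R₁.
    · have := eq_zero_of_shift_combination (r := g 0) (s := g 1) (t := g 2) (p := 0) (q := g 1)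
        (by rw [← h]; simp [Fin.sum_univ_three]; module)
      ext i; fin_cases i
      exacts [this.1, this.2.1, this.2.2.1]
    · rintro _ (rfl | rfl | rfl)
      exacts [Or.inr ⟨0, rfl⟩, Or.inr ⟨1, rfl⟩, Or.inl rfl]
    · fin_cases i
      exacts [Submodule.subset_span (Or.inl rfl), Submodule.subset_span (Or.inr (Or.inl rfl)),
        Submodule.subset_span (Or.inr (Or.inr rfl))]
    · rcases hX with rfl | rfl | rfl
      exacts [Submodule.subset_span ⟨0, rfl⟩, Submodule.subset_span ⟨1, rfl⟩,
        Submodule.subset_span ⟨2, rfl⟩]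
  · refine realizes_of_family hg ![opL₁, opR₁ + opY, 1, opYdag] (fun g h => ?_)
      (lie_sum_four hAB (by rw [h2, zero_smul]) hAY' (h2 _) hBY' (h1 _) 0 0)
      {opL₁, opR₁ + opY, opL₁ + opYdag, 1} ?_ (fun _ => ⟨Or.inl rfl, Or.inr (Or.inl rfl)⟩)
      (fun i => ?_) (fun X hX => ?_)
    · have := eq_zero_of_shift_combination (r := g 0) (s := g 1) (t := g 2) (p := g 3) (q := g 1)
        (by rw [← h]; simp [Fin.sum_univ_four]; module)
      ext i; fin_cases i
      exacts [this.1, this.2.1, this.2.2.1, this.2.2.2.1]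
    · rintro _ (rfl | rfl | rfl | rfl)
      exacts [Or.inr ⟨0, rfl⟩, Or.inr ⟨1, rfl⟩, Or.inr ⟨2, rfl⟩, Or.inl rfl]
    · fin_cases i
      · exact Submodule.subset_span (Or.inl rfl)
      · exact Submodule.subset_span (Or.inr (Or.inl rfl))
      · exact Submodule.subset_span (Or.inr (Or.inr (Or.inr rfl)))
      · have := Submodule.sub_mem (Submodule.span ℂ {opL₁, opR₁ + opY, opL₁ + opYdag, 1})
          (Submodule.subset_span (Or.inr (Or.inr (Or.inl rfl))))
          (Submodule.subset_span (Or.inl rfl))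
        rwa [add_sub_cancel_left] at this
    · rcases hX with rfl | rfl | rfl | rfl
      exacts [Submodule.subset_span ⟨0, rfl⟩, Submodule.subset_span ⟨1, rfl⟩,
        Submodule.add_mem _ (Submodule.subset_span ⟨0, rfl⟩) (Submodule.subset_span ⟨3, rfl⟩),
        Submodule.subset_span ⟨2, rfl⟩]
  · refine realizes_of_family hg ![opL₁, opR₁ + opY, 1, opYdag, -opY] (fun g h => ?_)
      (lie_sum_five hAB (by rw [h2, zero_smul]) (by rw [hAY', zero_smul])
        (by rw [h2, zero_smul]) hBY' (h1 _) hAY hBY (h1 _)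
        (by rw [lie_neg, ← lie_skew, lie_Y_Ydag]; simp))
      (insert 1 (Set.range shiftPair.op)) subset_rfl
      (fun _ => ⟨Or.inr ⟨0, rfl⟩, Or.inr ⟨1, rfl⟩⟩) (fun i => ?_) (fun X hX => ?_)
    -- Y occurs in B with coefficient g 1 and in −Y with coefficient −g 4.
    · have := eq_zero_of_shift_combination (r := g 0) (s := g 1) (t := g 2) (p := g 3)
        (q := g 1 - g 4) (by rw [← h]; simp [Fin.sum_univ_five]; module)
      ext i; fin_cases i
      exacts [this.1, this.2.1, this.2.2.1, this.2.2.2.1,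
        by simpa [this.2.1] using this.2.2.2.2]
    · have hop : ∀ i, shiftPair.op i ∈ Submodule.span ℂ (insert 1 (Set.range shiftPair.op)) :=
        fun i => Submodule.subset_span (Or.inr ⟨i, rfl⟩)
      fin_cases i
      · exact hop 0
      · exact hop 1
      · exact Submodule.subset_span (Or.inl rfl)
      · have := Submodule.sub_mem _ (hop 2) (hop 0)
        have h' : shiftPair.op 2 - shiftPair.op 0 = opYdag := add_sub_cancel_left _ _
        rwa [h'] at this
      · have := Submodule.sub_mem _ (hop 3) (hop 1)
        have h' : shiftPair.op 3 - shiftPair.op 1 = -opY := sub_add_cancel_left _ _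
        rwa [h'] at this
    · have hT : ∀ i, ![opL₁, opR₁ + opY, 1, opYdag, -opY] i ∈
          Submodule.span ℂ (Set.range ![opL₁, opR₁ + opY, 1, opYdag, -opY]) :=
        fun i => Submodule.subset_span ⟨i, rfl⟩
      rcases hX with rfl | ⟨i, rfl⟩
      · exact hT 2
      · fin_cases i
        · exact hT 0
        · exact hT 1
        · exact Submodule.add_mem _ (hT 0) (hT 3)
        · have := Submodule.add_mem _ (hT 1) (hT 4)
          have h' : ![opL₁, opR₁ + opY, 1, opYdag, -opY] 1 +
            ![opL₁, opR₁ + opY, 1, opYdag, -opY] 4 = opR₁ := add_neg_cancel_right _ _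
          rwa [h'] at this

/-- The five-dimensional Heisenberg algebra is realized. -/
theorem isRealizedStandard_of_twoMode {c d : ℂ} (hc : c ≠ 0) (hd : d ≠ 0)
    (hg : HasFlagForm 5 𝔤 0 0 c d) : IsRealizedStandard 𝔤 := by
  refine isRealizedStandard_of_realizes twoModePair_hasVacua ?_
  have h2 := decayOps_lie_one
  -- The order puts the conjugate pairs (L₁, R₁) and (L₂, R₂) into the slots (e₀,e₃) and (e₁,e₂);
  -- the scalings produce the prescribed c and d.
  refine realizes_of_family hg ![opL₁, opL₂, d • opR₂, c • opR₁, 1] (fun g h => ?_)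
      (lie_sum_five (by rw [lie_L₁_L₂, zero_smul]) (by rw [lie_smul, lie_L₁_R₂, zero_smul, smul_zero])
        (by rw [lie_smul, lie_L₁_R₁]) (by rw [lie_smul, lie_L₂_R₂])
        (by rw [lie_smul, lie_L₂_R₁, smul_zero])
        (by rw [lie_smul, smul_lie, lie_R₂_R₁, smul_zero, smul_zero]) (h2 _) (h2 _) (h2 _) (h2 _))
      (insert 1 (Set.range twoModePair.op)) subset_rfl
      (fun _ => ⟨Or.inr ⟨0, rfl⟩, Or.inr ⟨1, rfl⟩⟩) (fun i => ?_) (fun X hX => ?_)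
  · have := eq_zero_of_twoMode_combination (r := g 0) (s := g 3 * c) (t := g 4) (p := g 1)
        (q := g 2 * d) (by rw [← h]; simp [Fin.sum_univ_five]; module)
    simp only [mul_eq_zero, hc, hd, or_false] at this
    ext i; fin_cases i
    exacts [this.1, this.2.2.2.1, this.2.2.2.2, this.2.1, this.2.2.1]
  · have hop : ∀ i, twoModePair.op i ∈ Submodule.span ℂ (insert 1 (Set.range twoModePair.op)) :=
      fun i => Submodule.subset_span (Or.inr ⟨i, rfl⟩)
    fin_cases i
    · exact hop 0
    · have := Submodule.sub_mem _ (hop 2) (hop 0)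
      have h' : twoModePair.op 2 - twoModePair.op 0 = opL₂ := add_sub_cancel_left _ _
      rwa [h'] at this
    · have := Submodule.sub_mem _ (hop 1) (hop 3)
      have h' : twoModePair.op 1 - twoModePair.op 3 = opR₂ := add_sub_cancel_left _ _
      rw [h'] at this
      exact Submodule.smul_mem _ d this
    · exact Submodule.smul_mem _ c (hop 3)
    · exact Submodule.subset_span (Or.inl rfl)
  · have hT : ∀ i, ![opL₁, opL₂, d • opR₂, c • opR₁, 1] i ∈
        Submodule.span ℂ (Set.range ![opL₁, opL₂, d • opR₂, c • opR₁, 1]) :=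
      fun i => Submodule.subset_span ⟨i, rfl⟩
    have hR₁ : opR₁ ∈ Submodule.span ℂ (Set.range ![opL₁, opL₂, d • opR₂, c • opR₁, 1]) := by
      have h' : c⁻¹ • ![opL₁, opL₂, d • opR₂, c • opR₁, 1] 3 = opR₁ := inv_smul_smul₀ hc _
      have := Submodule.smul_mem _ c⁻¹ (hT 3)
      rwa [h'] at this
    have hR₂ : opR₂ ∈ Submodule.span ℂ (Set.range ![opL₁, opL₂, d • opR₂, c • opR₁, 1]) := by
      have h' : d⁻¹ • ![opL₁, opL₂, d • opR₂, c • opR₁, 1] 2 = opR₂ := inv_smul_smul₀ hd _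
      have := Submodule.smul_mem _ d⁻¹ (hT 2)
      rwa [h'] at this
    rcases hX with rfl | ⟨i, rfl⟩
    · exact hT 4
    · fin_cases i
      · exact hT 0
      · exact Submodule.add_mem _ hR₁ hR₂
      · exact Submodule.add_mem _ (hT 0) (hT 1)
      · exact hR₁

end Realization

/-! ### Models on the Schwartz space -/

lemma position_apply (f : SchwartzMap ℝ ℂ) (s : ℝ) : position f s = (s : ℂ) * f s := by
  have h : Function.HasTemperateGrowth (fun s : ℝ => (s : ℂ)) := by fun_prop
  exact SchwartzMap.smulLeftCLM_apply_apply h f s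

lemma momentum_apply (f : SchwartzMap ℝ ℂ) (s : ℝ) : momentum f s = -Complex.I * deriv f s := rfl

lemma affineOp_add (a b c a' b' c' : ℂ) :
    affineOp a b c + affineOp a' b' c' = affineOp (a + a') (b + b') (c + c') := by
  simp only [affineOp]; module

lemma affineOp_smul (t a b c : ℂ) : t • affineOp a b c = affineOp (t * a) (t * b) (t * c) := by
  simp only [affineOp]; module

lemma affineOp_sub (a b c a' b' c' : ℂ) :
    affineOp a b c - affineOp a' b' c' = affineOp (a - a') (b - b') (c - c') := by
  simp only [affineOp]; module

lemma ladderC_eq : ladderC = affineOp (Real.sqrt 2 : ℂ)⁻¹ ((Real.sqrt 2 : ℂ)⁻¹ * Complex.I) 0 := by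
  simp only [ladderC, affineOp]; module

lemma ladderCdag_eq :
    ladderCdag = affineOp (Real.sqrt 2 : ℂ)⁻¹ (-((Real.sqrt 2 : ℂ)⁻¹ * Complex.I)) 0 := by
  simp only [ladderCdag, affineOp]; module

lemma smul_one_eq (c : ℂ) : c • (1 : Module.End ℂ (SchwartzMap ℝ ℂ)) = affineOp 0 0 c := by
  simp only [affineOp]; module

lemma momentum_position (f : SchwartzMap ℝ ℂ) :
    position (momentum f) - momentum (position f) = Complex.I • f := by
  ext s
  have hd : deriv (position f) s = f s + s * deriv f s := by
    have h : (position f : ℝ → ℂ) = fun s : ℝ => (s : ℂ) * f s := funext (position_apply f)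
    rw [h, deriv_fun_mul]
    · have : deriv (fun s : ℝ => (s : ℂ)) s = 1 := (Complex.ofRealCLM.hasDerivAt (x := s)).deriv
      rw [this, one_mul]
    · exact Complex.ofRealCLM.differentiableAt
    · exact f.differentiableAt
  simp only [sub_apply, smul_apply, position_apply, momentum_apply, hd,
    smul_eq_mul]
  ring

lemma affineOp_commutator (a b c a' b' c' : ℂ) :
    affineOp a b c * affineOp a' b' c' - affineOp a' b' c' * affineOp a b c =
      (Complex.I * (a * b' - b * a')) • 1 := by
  have h : position * momentum = momentum * position + Complex.I • 1 := by
    refine LinearMap.ext fun f => ?_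
    have := momentum_position f
    rw [sub_eq_iff_eq_add'] at this
    exact this
  simp only [affineOp, add_mul, mul_add, smul_mul_smul_comm, mul_one, one_mul, h, smul_add]
  module

/-! #### Adjoints -/

lemma inner_schwartz (f g : SchwartzMap ℝ ℂ) :
    inner ℂ (schwartzIncl f) (schwartzIncl g) = ∫ s : ℝ, starRingEnd ℂ (f s) * g s := by
  have h := SchwartzMap.inner_toL2_toL2_eq f g MeasureTheory.volume
  refine h.trans (MeasureTheory.integral_congr_ae (Filter.Eventually.of_forall fun s => ?_))
  simp [mul_comm]

lemma inner_position (f g : SchwartzMap ℝ ℂ) :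
    inner ℂ (schwartzIncl (position f)) (schwartzIncl g) =
      inner ℂ (schwartzIncl f) (schwartzIncl (position g)) := by
  rw [inner_schwartz, inner_schwartz]
  refine MeasureTheory.integral_congr_ae (Filter.Eventually.of_forall fun s => ?_)
  simp only [position_apply, map_mul, Complex.conj_ofReal]
  ring

/-- Integration by parts for the pairing (f, g) ↦ f̄ g, which is bilinear over ℝ only. -/
lemma inner_deriv (f g : SchwartzMap ℝ ℂ) :
    ∫ s : ℝ, starRingEnd ℂ (deriv f s) * g s = -∫ s : ℝ, starRingEnd ℂ (f s) * deriv g s := by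
  have h := SchwartzMap.integral_bilinear_deriv_right_eq_neg_left f g
    ((ContinuousLinearMap.mul ℝ ℂ).comp (Complex.conjCLE : ℂ →L[ℝ] ℂ))
  simp at h
  rw [h, neg_neg]

lemma inner_momentum (f g : SchwartzMap ℝ ℂ) :
    inner ℂ (schwartzIncl (momentum f)) (schwartzIncl g) =
      inner ℂ (schwartzIncl f) (schwartzIncl (momentum g)) := by
  rw [inner_schwartz, inner_schwartz]
  have h1 : ∀ s : ℝ, starRingEnd ℂ (momentum f s) * g s =
      Complex.I * (starRingEnd ℂ (deriv f s) * g s) := by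
    intro s; rw [momentum_apply]; simp; ring
  have h2 : ∀ s : ℝ, starRingEnd ℂ (f s) * momentum g s =
      -Complex.I * (starRingEnd ℂ (f s) * deriv g s) := by
    intro s; rw [momentum_apply]; ring
  simp only [h1, h2, MeasureTheory.integral_const_mul, inner_deriv]
  ring

lemma inner_affineOp (a b c : ℂ) (f g : SchwartzMap ℝ ℂ) :
    inner ℂ (schwartzIncl (affineOp a b c f)) (schwartzIncl g) =
      inner ℂ (schwartzIncl f) (schwartzIncl (affineOp (starRingEnd ℂ a) (starRingEnd ℂ b)
        (starRingEnd ℂ c) g)) := by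
  simp only [affineOp, LinearMap.add_apply, LinearMap.smul_apply, Module.End.one_apply, map_add,
    map_smul, inner_add_left, inner_add_right, inner_smul_left, inner_smul_right, inner_position,
    inner_momentum]

lemma onL2_mul (X Y : Module.End ℂ (SchwartzMap ℝ ℂ)) : onL2 (X * Y) = onL2 X * onL2 Y := by
  exact LinearEquiv.conj_comp _ _ _

lemma onL2_sub (X Y : Module.End ℂ (SchwartzMap ℝ ℂ)) : onL2 (X - Y) = onL2 X - onL2 Y :=
  map_sub _ _ _

lemma onL2_smul (c : ℂ) (X : Module.End ℂ (SchwartzMap ℝ ℂ)) : onL2 (c • X) = c • onL2 X :=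
  map_smul _ _ _

lemma onL2_one : onL2 1 = 1 := LinearEquiv.conj_id _

lemma onL2_apply (X : Module.End ℂ (SchwartzMap ℝ ℂ)) (f : SchwartzMap ℝ ℂ) :
    (onL2 X ⟨schwartzIncl f, f, rfl⟩ : L2R) = schwartzIncl (X f) := by
  have h : (LinearEquiv.ofInjective schwartzIncl schwartzIncl_injective).symm
      ⟨schwartzIncl f, f, rfl⟩ = f :=
    (LinearEquiv.ofInjective schwartzIncl schwartzIncl_injective).symm_apply_apply f
  exact congrArg (fun f => schwartzIncl (X f)) h

lemma isDagger_affineOp (a b c : ℂ) : IsDagger (onL2 (affineOp a b c))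
    (onL2 (affineOp (starRingEnd ℂ a) (starRingEnd ℂ b) (starRingEnd ℂ c))) := by
  rintro ⟨_, f, rfl⟩ ⟨_, g, rfl⟩
  rw [onL2_apply, onL2_apply]
  exact inner_affineOp a b c f g

lemma onL2_affineOp_commutator (a b c a' b' c' : ℂ) :
    onL2 (affineOp a b c) * onL2 (affineOp a' b' c') -
      onL2 (affineOp a' b' c') * onL2 (affineOp a b c) = (Complex.I * (a * b' - b * a')) • 1 := by
  rw [← onL2_mul, ← onL2_mul, ← onL2_sub, affineOp_commutator, onL2_smul, onL2_one]

lemma dense_schwartzDomain : Dense (schwartzDomain : Set L2R) := by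
  -- The inclusion taken over real scalars is the same function, hence has the same range.
  have h : DenseRange (SchwartzMap.toLpCLM ℝ ℂ 2
      (MeasureTheory.volume : MeasureTheory.Measure ℝ)) :=
    SchwartzMap.denseRange_toLpCLM (by simp)
  exact h

/-- Two first-order operators with `[A, B] = 1` give a model whose structure constants are the
commutators of the coefficients. -/
theorem isModel_affineOp {u w c u' w' c' : ℂ} (h : Complex.I * (u * w' - w * u') = 1)
    {ω : Matrix (Fin 4) (Fin 4) ℂ}
    (hω : ∀ i j : Fin 4, i < j → ω i j = Complex.I *
      ((![u, u', starRingEnd ℂ u', starRingEnd ℂ u] : Fin 4 → ℂ) i *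
        (![w, w', starRingEnd ℂ w', starRingEnd ℂ w] : Fin 4 → ℂ) j -
      (![w, w', starRingEnd ℂ w', starRingEnd ℂ w] : Fin 4 → ℂ) i *
        (![u, u', starRingEnd ℂ u', starRingEnd ℂ u] : Fin 4 → ℂ) j)) :
    IsModel (affineOp u w c) (affineOp u' w' c') ω := by
  refine ⟨dense_schwartzDomain,
    { A := onL2 (affineOp u w c)
      B := onL2 (affineOp u' w' c')
      Adag := _
      Bdag := _
      isDagger_A := isDagger_affineOp u w c
      isDagger_B := isDagger_affineOp u' w' c'
      ccr := fun f => ?_ }, rfl, rfl, fun i j hij => ?_⟩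
  · have h1 := onL2_affineOp_commutator u w c u' w' c'
    rw [h, one_smul] at h1
    exact LinearMap.congr_fun h1 f
  · rw [hω i j hij]
    apply Subtype.ext
    fin_cases i <;> fin_cases j <;> first
      | exact absurd hij (by decide)
      | exact onL2_affineOp_commutator _ _ _ _ _ _

/-! ### Unique realizability -/

section Unique

variable {𝔤 : Type*} [LieRing 𝔤] [LieAlgebra ℂ 𝔤]

lemma isNilpotent_of_lie_lie_eq_zero (h : ∀ x y z : 𝔤, ⁅x, ⁅y, z⁆⁆ = 0) :
    LieRing.IsNilpotent 𝔤 := by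
  refine (LieModule.isNilpotent_iff ℂ 𝔤 𝔤).2 ⟨2, ?_⟩
  have h1 : LieModule.lowerCentralSeries ℂ 𝔤 𝔤 1 ≤ LieAlgebra.center ℂ 𝔤 := by
    rw [LieModule.lowerCentralSeries_succ, LieSubmodule.lie_le_iff]
    intro x _ m _
    exact (LieModule.mem_maxTrivSubmodule ℂ 𝔤 𝔤 _).2 fun y => h y x m
  rw [LieModule.lowerCentralSeries_succ, eq_bot_iff, LieSubmodule.lie_le_iff]
  intro x _ m hm
  exact (LieSubmodule.mem_bot _).2 ((LieModule.mem_maxTrivSubmodule ℂ 𝔤 𝔤 m).1 (h1 hm) x)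

lemma HasFlagForm.of_equiv {n : ℕ} {𝔥 : Type*} [LieRing 𝔥] [LieAlgebra ℂ 𝔥] {a b c d : ℂ}
    (hg : HasFlagForm n 𝔤 a b c d) (f : 𝔥 ≃ₗ⁅ℂ⁆ 𝔤) : HasFlagForm n 𝔥 a b c d := by
  obtain ⟨e, he⟩ := hg
  exact ⟨f.toLinearEquiv.trans e, fun x y => (congrArg e (LieEquiv.map_lie f x y)).trans (he _ _)⟩

lemma HasFlagForm.finrank_eq {n : ℕ} {a b c d : ℂ} (hg : HasFlagForm n 𝔤 a b c d) :
    Module.finrank ℂ 𝔤 = n := by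
  obtain ⟨e, -⟩ := hg
  rw [e.finrank_eq, Module.finrank_fin_fun]

lemma HasFlagForm.finiteDimensional {n : ℕ} {a b c d : ℂ} (hg : HasFlagForm n 𝔤 a b c d) :
    FiniteDimensional ℂ 𝔤 := by
  obtain ⟨e, -⟩ := hg
  exact e.symm.finiteDimensional

lemma HasFlagForm.isNilpotent {n : ℕ} (hg : HasFlagForm n 𝔤 1 0 0 0) :
    LieRing.IsNilpotent 𝔤 := by
  obtain ⟨e, he⟩ := hg
  refine isNilpotent_of_lie_lie_eq_zero fun x y z => e.injective ?_
  rw [he, he, map_zero]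
  ext ⟨k, hk⟩
  simp only [flagBracket_apply (k := ⟨k, hk⟩), flagFun, minor, zero_mul, add_zero, Pi.zero_apply]
  split_ifs with h2
  · subst h2
    rw [coord_flagBracket _ _ _ _ _ _ _ 0 (by omega) (by omega),
      coord_flagBracket _ _ _ _ _ _ _ 1 (by omega) (by omega)]
    simp
  all_goals rfl

/-- The deformation half comes from the flag family, which contains every nilpotent algebra of this
dimension; a standard realization is the remaining content. -/
lemma HasFlagForm.isUniquelyRealized {n : ℕ} (h5 : n ≤ 5) {a b c d : ℂ}
    (hg : HasFlagForm n 𝔤 a b c d) (hr : IsRealizedStandard 𝔤) : IsUniquelyRealized 𝔤 := by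
  refine ⟨hr, fun 𝔯 _ _ _ _ hn _ => ?_⟩
  rw [hg.finrank_eq] at hn
  obtain ⟨_, _, _, _, hr'⟩ := exists_flagForm h5 hn
  exact hg.deformsTo hr'

end Unique

/-- The Lie algebra `ℂⁿ` with the only nonzero bracket `[e₀, e₁] = e₂`. -/
def HeisenbergSum (n : ℕ) : Type := Fin n → ℂ

namespace HeisenbergSum

variable (n : ℕ)

instance : AddCommGroup (HeisenbergSum n) := inferInstanceAs (AddCommGroup (Fin n → ℂ))

instance : Module ℂ (HeisenbergSum n) := inferInstanceAs (Module ℂ (Fin n → ℂ))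

/-- The bracket of `HeisenbergSum n`. -/
def lieMap : HeisenbergSum n →ₗ[ℂ] HeisenbergSum n →ₗ[ℂ] HeisenbergSum n := flagBracket n 1 0 0 0

lemma isLieBracket_lieMap : IsLieBracket (lieMap n) := isLieBracket_flagBracket n 1 0 0 0

instance : Bracket (HeisenbergSum n) (HeisenbergSum n) := ⟨fun x y => lieMap n x y⟩

lemma lie_eq (x y : HeisenbergSum n) : ⁅x, y⁆ = lieMap n x y := rfl

lemma lieMap_skew (x y : HeisenbergSum n) : lieMap n x y = -lieMap n y x := by
  have h := (isLieBracket_lieMap n).1 (x + y)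
  simp only [map_add, LinearMap.add_apply, (isLieBracket_lieMap n).1, zero_add, add_zero] at h
  exact eq_neg_of_add_eq_zero_right h

instance : LieRing (HeisenbergSum n) where
  add_lie x y z := by simp [lie_eq]
  lie_add x y z := by simp [lie_eq]
  lie_self x := (isLieBracket_lieMap n).1 x
  leibniz_lie x y z := by
    have h := (isLieBracket_lieMap n).2 x y z
    simp only [lie_eq]
    rw [lieMap_skew n (lieMap n x y) z, lieMap_skew n x z, map_neg] at *
    rw [← sub_eq_zero, ← h]
    abel

instance : LieAlgebra ℂ (HeisenbergSum n) where
  lie_smul t x y := map_smul (lieMap n x) t y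

lemma hasFlagForm : HasFlagForm n (HeisenbergSum n) 1 0 0 0 :=
  ⟨LinearEquiv.refl ℂ (Fin n → ℂ), fun _ _ => rfl⟩

end HeisenbergSum

/-! ### Central extensions by a form of rank two -/

section Rank

variable (ω : Matrix (Fin 4) (Fin 4) ℂ)

lemma finrank_centralExt : Module.finrank ℂ (CentralExt ω) = 5 := by
  have h : Module.finrank ℂ (CentralExt ω) = Module.finrank ℂ ((Fin 4 → ℂ) × ℂ) := rfl
  rw [h]; simp

instance finiteDimensional_centralExt : FiniteDimensional ℂ (CentralExt ω) :=
  inferInstanceAs (FiniteDimensional ℂ ((Fin 4 → ℂ) × ℂ))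

lemma centralExt_lie (x y : CentralExt ω) :
    ⁅x, y⁆ = ((0, CentralExt.form ω x.1 y.1) : (Fin 4 → ℂ) × ℂ) := rfl

lemma isNilpotent_centralExt : LieRing.IsNilpotent (CentralExt ω) :=
  isNilpotent_of_lie_lie_eq_zero fun x y z => by
    rw [centralExt_lie ω x, centralExt_lie ω y]
    simp only [CentralExt.form_zero_right]
    rfl

lemma form_n52Form (x y : Fin 4 → ℂ) : CentralExt.form n52Form x y = x 0 * y 1 - x 1 * y 0 := by
  simp [CentralExt.form, n52Form, Fin.sum_univ_four]

variable {ω}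

/-- Modulo scalars the four operators are uᵢ x + wᵢ p, so the commutator form is i times the wedge
of the functionals u and w. -/
lemma form_of_rank_two {u w : Fin 4 → ℂ}
    (hω : ∀ i j, i < j → ω i j = Complex.I * (u i * w j - w i * u j)) (x y : Fin 4 → ℂ) :
    CentralExt.form ω x y = Complex.I *
      ((u 0 * x 0 + u 1 * x 1 + u 2 * x 2 + u 3 * x 3) *
        (w 0 * y 0 + w 1 * y 1 + w 2 * y 2 + w 3 * y 3) -
      (w 0 * x 0 + w 1 * x 1 + w 2 * x 2 + w 3 * x 3) *
        (u 0 * y 0 + u 1 * y 1 + u 2 * y 2 + u 3 * y 3)) := by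
  simp [CentralExt.form, Fin.sum_univ_four, hω 0 1 (by decide), hω 0 2 (by decide),
    hω 0 3 (by decide), hω 1 2 (by decide), hω 1 3 (by decide), hω 2 3 (by decide)]
  ring

/-- The coordinate change that brings a form of rank two to normal form. -/
def rankTwoMap (u w : Fin 4 → ℂ) : CentralExt ω →ₗ[ℂ] CentralExt n52Form where
  -- The factor i is absorbed into the first coordinate, which turns i u∧w into x₀y₁ − x₁y₀.
  toFun x := ((![Complex.I * (u 0 * x.1 0 + u 1 * x.1 1 + u 2 * x.1 2 + u 3 * x.1 3),
    w 0 * x.1 0 + w 1 * x.1 1 + w 2 * x.1 2 + w 3 * x.1 3, x.1 2, x.1 3], x.2) :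
      (Fin 4 → ℂ) × ℂ)
  map_add' x y := by
    refine Prod.ext ?_ rfl
    ext i
    fin_cases i
    · change Complex.I * (u 0 * (x.1 0 + y.1 0) + u 1 * (x.1 1 + y.1 1) + u 2 * (x.1 2 + y.1 2) +
        u 3 * (x.1 3 + y.1 3)) = _ * (_ + _ + _ + _) + _ * (_ + _ + _ + _)
      ring
    · change w 0 * (x.1 0 + y.1 0) + w 1 * (x.1 1 + y.1 1) + w 2 * (x.1 2 + y.1 2) +
        w 3 * (x.1 3 + y.1 3) = (_ + _ + _ + _) + (_ + _ + _ + _)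
      ring
    · rfl
    · rfl
  map_smul' t x := by
    refine Prod.ext ?_ rfl
    ext i
    fin_cases i
    · change Complex.I * (u 0 * (t * x.1 0) + u 1 * (t * x.1 1) + u 2 * (t * x.1 2) +
        u 3 * (t * x.1 3)) = t * (_ * (_ + _ + _ + _))
      ring
    · change w 0 * (t * x.1 0) + w 1 * (t * x.1 1) + w 2 * (t * x.1 2) +
        w 3 * (t * x.1 3) = t * (_ + _ + _ + _)
      ring
    · rfl
    · rfl

/-- The hypothesis is [A,B] = 𝕀: it makes the block on the first two coordinates invertible, while
the last two coordinates are kept. -/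
lemma rankTwoMap_injective {u w : Fin 4 → ℂ} (h : Complex.I * (u 0 * w 1 - w 0 * u 1) = 1) :
    Function.Injective (rankTwoMap (ω := ω) u w) := by
  rw [injective_iff_map_eq_zero]
  intro x hx
  have h1 : (rankTwoMap u w x).1 = (0 : Fin 4 → ℂ) := congrArg Prod.fst hx
  have h2 : x.2 = 0 := congrArg Prod.snd hx
  have e0 : Complex.I * (u 0 * x.1 0 + u 1 * x.1 1 + u 2 * x.1 2 + u 3 * x.1 3) = 0 :=
    congrFun h1 0
  have e1 : w 0 * x.1 0 + w 1 * x.1 1 + w 2 * x.1 2 + w 3 * x.1 3 = 0 := congrFun h1 1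
  have e2 : x.1 2 = 0 := congrFun h1 2
  have e3 : x.1 3 = 0 := congrFun h1 3
  rw [e2, e3] at e0 e1
  have f0 : x.1 0 = 0 := by
    linear_combination w 1 * e0 - Complex.I * u 1 * e1 - x.1 0 * h
  have f1 : x.1 1 = 0 := by
    linear_combination Complex.I * u 0 * e1 - w 0 * e0 - x.1 1 * h
  refine Prod.ext ?_ h2
  ext i
  fin_cases i
  exacts [f0, f1, e2, e3]

lemma isNilpotentN52_of_rank_two {u w : Fin 4 → ℂ}
    (h : Complex.I * (u 0 * w 1 - w 0 * u 1) = 1)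
    (hω : ∀ i j, i < j → ω i j = Complex.I * (u i * w j - w i * u j)) :
    IsNilpotentN52 (CentralExt ω) := by
  refine ⟨isNilpotent_centralExt ω, finrank_centralExt ω, ⟨?_⟩⟩
  refine
    { LinearMap.linearEquivOfInjective (rankTwoMap u w) (rankTwoMap_injective h)
        (by rw [finrank_centralExt, finrank_centralExt]) with
      map_lie' := ?_ }
  intro x y
  change rankTwoMap u w ⁅x, y⁆ = ⁅rankTwoMap u w x, rankTwoMap u w y⁆
  rw [centralExt_lie, centralExt_lie, form_of_rank_two hω, form_n52Form]
  refine Prod.ext ?_ ?_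
  · ext i
    fin_cases i
    · change Complex.I * (u 0 * 0 + u 1 * 0 + u 2 * 0 + u 3 * 0) = 0
      ring
    · change w 0 * 0 + w 1 * 0 + w 2 * 0 + w 3 * 0 = (0 : ℂ)
      ring
    · rfl
    · rfl
  · change Complex.I * (_ * _ - _ * _) =
      (Complex.I * _) * (_ + _ + _ + _) - (_ + _ + _ + _) * (Complex.I * _)
    ring

end Rank

lemma hasFlagForm_n52Form : HasFlagForm 5 (CentralExt n52Form) 1 0 0 0 := by
  let v : Fin 4 → CentralExt n52Form := fun i => ((Pi.single i 1, 0) : (Fin 4 → ℂ) × ℂ)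
  let z : CentralExt n52Form := ((0, 1) : (Fin 4 → ℂ) × ℂ)
  have hv : ∀ i j (t : ℂ), (Pi.single i 1 : Fin 4 → ℂ) 0 * (Pi.single j 1 : Fin 4 → ℂ) 1 -
      (Pi.single i 1 : Fin 4 → ℂ) 1 * (Pi.single j 1 : Fin 4 → ℂ) 0 = t → ⁅v i, v j⁆ = t • z := by
    rintro i j _ rfl
    rw [centralExt_lie, form_n52Form]
    exact Prod.ext (smul_zero _).symm (mul_one _).symm
  have h0 : ∀ i j, (Pi.single i 1 : Fin 4 → ℂ) 0 * (Pi.single j 1 : Fin 4 → ℂ) 1 -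
      (Pi.single i 1 : Fin 4 → ℂ) 1 * (Pi.single j 1 : Fin 4 → ℂ) 0 = 0 → ⁅v i, v j⁆ = 0 :=
    fun i j h => (hv i j 0 h).trans (zero_smul _ _)
  have hz : ∀ x : CentralExt n52Form, ⁅x, z⁆ = 0 := by
    intro x
    rw [centralExt_lie]
    change ((0, CentralExt.form n52Form x.1 0) : (Fin 4 → ℂ) × ℂ) = 0
    rw [CentralExt.form_zero_right]
    rfl
  have h3 : ∀ x : CentralExt n52Form, ⁅x, v 3⁆ = 0 := by
    intro x
    rw [centralExt_lie, form_n52Form]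
    change ((0, x.1 0 * (Pi.single 3 1 : Fin 4 → ℂ) 1 - x.1 1 * (Pi.single 3 1 : Fin 4 → ℂ) 0) :
      (Fin 4 → ℂ) × ℂ) = 0
    simp
  -- The bracket value v takes the slot e₂; the two abelian directions take the slots e₃ and e₄.
  refine hasFlagForm_five (finrank_centralExt _) (e₁ := v 0) (e₂ := v 1) (e₃ := z) (e₄ := v 2)
    (e₅ := v 3) (fun x => ⟨x.1 0, x.1 1, x.2, x.1 2, x.1 3, Prod.ext ?_ ?_⟩)
    (hv 0 1 1 (by simp)) ?_ ?_ ?_ (h0 1 2 (by simp)) ?_ h3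
  · ext i
    change x.1 i = x.1 0 * (Pi.single 0 1 : Fin 4 → ℂ) i + x.1 1 * (Pi.single 1 1 : Fin 4 → ℂ) i +
      x.2 * 0 + x.1 2 * (Pi.single 2 1 : Fin 4 → ℂ) i + x.1 3 * (Pi.single 3 1 : Fin 4 → ℂ) i
    fin_cases i <;> simp
  · change x.2 = x.1 0 * 0 + x.1 1 * 0 + x.2 * 1 + x.1 2 * 0 + x.1 3 * 0
    ring
  · rw [hz, zero_smul]
  · rw [h0 0 2 (by simp), zero_smul]
  · rw [hz, zero_smul]
  · rw [← lie_skew, hz, neg_zero]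

lemma IsNilpotentN52.isUniquelyRealized {𝔤 : Type*} [LieRing 𝔤] [LieAlgebra ℂ 𝔤]
    (h : IsNilpotentN52 𝔤) : IsUniquelyRealized 𝔤 := by
  obtain ⟨-, -, ⟨f⟩⟩ := h
  have hg := hasFlagForm_n52Form.of_equiv f
  exact hg.isUniquelyRealized le_rfl (isRealizedStandard_of_heisenberg le_rfl hg)

/-- Lie algebras of dimension five with one-dimensional center equal to the derived algebra. -/
theorem isUniquelyRealized_of_center {𝔰 : Type*} [LieRing 𝔰] [LieAlgebra ℂ 𝔰]
    [FiniteDimensional ℂ 𝔰]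
    (hd : (⁅(⊤ : LieIdeal ℂ 𝔰), (⊤ : LieIdeal ℂ 𝔰)⁆ : LieIdeal ℂ 𝔰) = LieAlgebra.center ℂ 𝔰)
    (h1 : Module.finrank ℂ (LieAlgebra.center ℂ 𝔰) = 1)
    (h4 : Module.finrank ℂ (𝔰 ⧸ LieAlgebra.center ℂ 𝔰) = 4) : IsUniquelyRealized 𝔰 := by
  have hn : Module.finrank ℂ 𝔰 = 5 := by
    have h := Submodule.finrank_quotient_add_finrank (LieAlgebra.center ℂ 𝔰).toSubmodule
    have h4' : Module.finrank ℂ (𝔰 ⧸ (LieAlgebra.center ℂ 𝔰).toSubmodule) = 4 := h4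
    have h1' : Module.finrank ℂ (LieAlgebra.center ℂ 𝔰).toSubmodule = 1 := h1
    omega
  have hmem : ∀ z : 𝔰, z ∈ LieAlgebra.center ℂ 𝔰 ↔ ∀ x : 𝔰, ⁅x, z⁆ = 0 := fun z =>
    LieModule.mem_maxTrivSubmodule ℂ 𝔰 𝔰 z
  have hlie : ∀ x y : 𝔰, ⁅x, y⁆ ∈ LieAlgebra.center ℂ 𝔰 := fun x y =>
    hd ▸ LieSubmodule.lie_mem_lie (LieSubmodule.mem_top x) (LieSubmodule.mem_top y)
  have hnil : LieRing.IsNilpotent 𝔰 :=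
    isNilpotent_of_lie_lie_eq_zero fun x y z => (hmem _).1 (hlie y z) x
  obtain ⟨a, b, c, d, hg⟩ := exists_flagForm le_rfl hn
  obtain ⟨e, he⟩ := id hg
  have hcen : ∀ z : Fin 5 → ℂ, (∀ x, flagBracket 5 a b c d x z = 0) →
      e.symm z ∈ LieAlgebra.center ℂ 𝔰 := by
    intro z hz
    refine (hmem _).2 fun x => e.injective ?_
    rw [he, LinearEquiv.apply_symm_apply, hz, map_zero]
  -- The vector e₄ is central for all parameters, so the one-dimensional center is its line.
  have h4cen : e.symm (Pi.single 4 1) ∈ LieAlgebra.center ℂ 𝔰 := by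
    refine hcen _ fun x => ?_
    ext k
    fin_cases k <;> simp [flagBracket_apply, flagFun, minor, coord_eq]
  have hline : ∀ z : Fin 5 → ℂ, e.symm z ∈ LieAlgebra.center ℂ 𝔰 → ∃ t : ℂ,
      z = t • Pi.single 4 1 := by
    intro z hz
    have hne : (⟨_, h4cen⟩ : LieAlgebra.center ℂ 𝔰) ≠ 0 := by
      intro h
      have h' := (LinearEquiv.map_eq_zero_iff e.symm).1 (congrArg Subtype.val h)
      simpa using congrFun h' 4
    obtain ⟨t, ht⟩ := (finrank_eq_one_iff_of_nonzero' _ hne).1 h1 ⟨_, hz⟩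
    refine ⟨t, e.symm.injective ?_⟩
    rw [map_smul]
    exact (congrArg Subtype.val ht).symm
  -- All brackets are central, hence multiples of e₄. This excludes the components a along e₂ and b
  -- along e₃.
  have hbr : ∀ x y : Fin 5 → ℂ, ∃ t : ℂ, flagBracket 5 a b c d x y = t • Pi.single 4 1 := by
    intro x y
    refine hline _ ?_
    have h := he (e.symm x) (e.symm y)
    rw [LinearEquiv.apply_symm_apply, LinearEquiv.apply_symm_apply] at h
    rw [← h, LinearEquiv.symm_apply_apply]
    exact hlie _ _
  have ha : a = 0 := by
    obtain ⟨t, ht⟩ := hbr (Pi.single 0 1) (Pi.single 1 1)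
    simpa [flagBracket_apply, flagFun, minor, coord_eq] using congrFun ht 2
  have hb : b = 0 := by
    obtain ⟨t, ht⟩ := hbr (Pi.single 0 1) (Pi.single 2 1)
    simpa [flagBracket_apply, flagFun, minor, coord_eq] using congrFun ht 3
  subst ha hb
  -- Now e₃ would be central if c = 0, and e₂ if d = 0; both contradict a center equal to the line
  -- of e₄.
  have hc : c ≠ 0 := by
    rintro rfl
    obtain ⟨t, ht⟩ := hline (Pi.single 3 1) (hcen _ fun x => by
      ext k
      fin_cases k <;> simp [flagBracket_apply, flagFun, minor, coord_eq])
    simpa using congrFun ht 3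
  have hd' : d ≠ 0 := by
    rintro rfl
    obtain ⟨t, ht⟩ := hline (Pi.single 2 1) (hcen _ fun x => by
      ext k
      fin_cases k <;> simp [flagBracket_apply, flagFun, minor, coord_eq])
    simpa using congrFun ht 2
  exact hg.isUniquelyRealized le_rfl (isRealizedStandard_of_twoMode hc hd' hg)

/-! ### The three models -/

/-- A model given by two first-order operators with `[A, B] = 1`. -/
theorem model_of_affineOp {u w c u' w' c' : ℂ} (h : Complex.I * (u * w' - w * u') = 1)
    {ω : Matrix (Fin 4) (Fin 4) ℂ}
    (hω : ∀ i j : Fin 4, i < j → ω i j = Complex.I *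
      ((![u, u', starRingEnd ℂ u', starRingEnd ℂ u] : Fin 4 → ℂ) i *
        (![w, w', starRingEnd ℂ w', starRingEnd ℂ w] : Fin 4 → ℂ) j -
      (![w, w', starRingEnd ℂ w', starRingEnd ℂ w] : Fin 4 → ℂ) i *
        (![u, u', starRingEnd ℂ u', starRingEnd ℂ u] : Fin 4 → ℂ) j)) :
    IsModel (affineOp u w c) (affineOp u' w' c') ω ∧ IsNilpotentN52 (CentralExt ω) ∧
      IsUniquelyRealized (CentralExt ω) := by
  have h52 : IsNilpotentN52 (CentralExt ω) := isNilpotentN52_of_rank_two (by simpa using h) hω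
  exact ⟨isModel_affineOp h hω, h52, h52.isUniquelyRealized⟩

lemma inv_sqrt_two_mul_self : (Real.sqrt 2 : ℂ)⁻¹ * (Real.sqrt 2 : ℂ)⁻¹ = 1 / 2 := by
  rw [← mul_inv, ← Complex.ofReal_mul, Real.mul_self_sqrt (by norm_num)]
  norm_num

/-- Scalars drop out of commutators, so for all α, β the structure constants are those of C and C†.
-/
theorem model_shifted (α β : ℂ) :
    IsModel (ladderC - α • 1) (ladderCdag - (starRingEnd ℂ β) • 1) shiftedForm ∧
      IsNilpotentN52 (CentralExt shiftedForm) := by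
  have hs := inv_sqrt_two_mul_self
  rw [ladderC_eq, ladderCdag_eq, smul_one_eq, smul_one_eq, affineOp_sub, affineOp_sub]
  have h := model_of_affineOp (u := (Real.sqrt 2 : ℂ)⁻¹ - 0)
    (w := (Real.sqrt 2 : ℂ)⁻¹ * Complex.I - 0) (c := 0 - α) (u' := (Real.sqrt 2 : ℂ)⁻¹ - 0)
    (w' := -((Real.sqrt 2 : ℂ)⁻¹ * Complex.I) - 0) (c' := 0 - starRingEnd ℂ β) (ω := shiftedForm)
    (by linear_combination (-2 * Complex.I ^ 2) * hs - Complex.I_sq) (by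
      intro i j hij
      fin_cases i <;> fin_cases j <;> first
        | exact absurd hij (by decide)
        | (simp [shiftedForm]; ring1)
        | (simp [shiftedForm]; linear_combination (2 * Complex.I ^ 2) * hs + Complex.I_sq)
        | (simp [shiftedForm]; linear_combination (-2 * Complex.I ^ 2) * hs - Complex.I_sq))
  exact ⟨h.1, h.2.1⟩

theorem model_deformed {a b a' b' : ℂ} (c c' : ℂ) (h : a * b' - b * a' = 1) :
    IsModel ((Real.sqrt 2 : ℂ)⁻¹ • (affineOp a b c + Complex.I • affineOp a' b' c'))
        ((Real.sqrt 2 : ℂ)⁻¹ • (affineOp a b c - Complex.I • affineOp a' b' c'))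
        (deformedForm a b a' b') ∧
      IsNilpotentN52 (CentralExt (deformedForm a b a' b')) ∧
      IsUniquelyRealized (CentralExt (deformedForm a b a' b')) := by
  have hs := inv_sqrt_two_mul_self
  rw [affineOp_smul, affineOp_add, affineOp_sub, affineOp_smul, affineOp_smul]
  refine model_of_affineOp ?_ ?_
  -- This is [A,B] = −i[Q,P] = 1, from (1/√2)² = 1/2, i² = −1 and ab′ − ba′ = 1.
  · linear_combination (-2 * Complex.I ^ 2 * (a * b' - b * a')) * hs -
      Complex.I_sq * (a * b' - b * a') + h
  · intro i j hij
    simp only [deformedForm, div_eq_inv_mul, Matrix.of_apply]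

theorem model_swanson (θ : ℝ) :
    IsModel ((Real.cos θ : ℂ) • ladderC + (Complex.I * Real.sin θ) • ladderCdag)
        ((Real.cos θ : ℂ) • ladderCdag + (Complex.I * Real.sin θ) • ladderC) (swansonForm θ) ∧
      IsNilpotentN52 (CentralExt (swansonForm θ)) ∧
      IsUniquelyRealized (CentralExt (swansonForm θ)) := by
  have hs := inv_sqrt_two_mul_self
  have hp : (Real.cos θ : ℂ) ^ 2 + (Real.sin θ : ℂ) ^ 2 = 1 := by
    rw [← Complex.ofReal_pow, ← Complex.ofReal_pow, ← Complex.ofReal_add, Real.cos_sq_add_sin_sq,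
      Complex.ofReal_one]
  have hs2 : (Real.sin (2 * θ) : ℂ) = 2 * Real.sin θ * Real.cos θ := by
    rw [Real.sin_two_mul, Complex.ofReal_mul, Complex.ofReal_mul, Complex.ofReal_ofNat]
  have hc2 : (Real.cos (2 * θ) : ℂ) = (Real.cos θ : ℂ) ^ 2 - (Real.sin θ : ℂ) ^ 2 := by
    rw [Real.cos_two_mul', Complex.ofReal_sub, Complex.ofReal_pow, Complex.ofReal_pow]
  have hI := Complex.I_mul_I
  rw [ladderC_eq, ladderCdag_eq]
  simp only [affineOp_smul, affineOp_add]
  refine model_of_affineOp ?_ ?_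
  · generalize (Real.cos θ : ℂ) = C at *
    generalize (Real.sin θ : ℂ) = S at *
    generalize (Real.sqrt 2 : ℂ)⁻¹ = r at *
    generalize Complex.I = I at *
    grind
  · intro i j hij
    -- Conjugates are evaluated before i, cos θ, sin θ and 1/√2 become atoms; the rest is polynomial
    -- algebra modulo their quadratic relations.
    simp only [swansonForm, hs2, hc2, map_add, map_mul, map_neg, map_inv₀, Complex.conj_ofReal,
      Complex.conj_I]
    generalize (Real.cos θ : ℂ) = C at *
    generalize (Real.sin θ : ℂ) = S at *
    generalize (Real.sqrt 2 : ℂ)⁻¹ = r at *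
    generalize Complex.I = I at *
    fin_cases i <;> fin_cases j <;> first
      | exact absurd hij (by decide)
      | (simp; grind)

end

end Pseudoboson

theorem theorem4p1 :
    -- one realized algebra in each dimension, to which all others deform, unique up to deformation
    (∀ n : ℕ, n ≤ 5 →
      ∃ (𝔯 : Type) (_ : LieRing 𝔯) (_ : LieAlgebra ℂ 𝔯),
        FiniteDimensional ℂ 𝔯 ∧ LieRing.IsNilpotent 𝔯 ∧ Module.finrank ℂ 𝔯 = n ∧
        IsUniquelyRealized 𝔯 ∧
        ∀ (𝔤 : Type*) [LieRing 𝔤] [LieAlgebra ℂ 𝔤] [FiniteDimensional ℂ 𝔤]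
          [LieRing.IsNilpotent 𝔤], Module.finrank ℂ 𝔤 = n →
          DeformsTo 𝔤 𝔯 ∧ DeformsTo 𝔯 𝔤 ∧
          ∀ (𝔯' : Type) [LieRing 𝔯'] [LieAlgebra ℂ 𝔯'] [FiniteDimensional ℂ 𝔯']
            [LieRing.IsNilpotent 𝔯'], Module.finrank ℂ 𝔯' = n → IsRealized 𝔯' →
            DeformsTo 𝔤 𝔯') ∧
    -- the shifted harmonic oscillator
    (∀ α β : ℂ, α ≠ β →
      IsModel (ladderC - α • 1) (ladderCdag - (starRingEnd ℂ β) • 1) shiftedForm) ∧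
    IsNilpotentN52 (CentralExt shiftedForm) ∧
    -- every Lie algebra isomorphic to the one of the shifted harmonic oscillator
    (∀ (𝔟 : Type*) [LieRing 𝔟] [LieAlgebra ℂ 𝔟],
      Nonempty (𝔟 ≃ₗ⁅ℂ⁆ CentralExt shiftedForm) → IsUniquelyRealized 𝔟) ∧
    -- deformed position and momentum operators
    (∀ a b c a' b' c' : ℂ, a * b' - b * a' = 1 →
      IsModel ((Real.sqrt 2 : ℂ)⁻¹ • (affineOp a b c + Complex.I • affineOp a' b' c'))
        ((Real.sqrt 2 : ℂ)⁻¹ • (affineOp a b c - Complex.I • affineOp a' b' c'))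
        (deformedForm a b a' b') ∧
      IsNilpotentN52 (CentralExt (deformedForm a b a' b')) ∧
      IsUniquelyRealized (CentralExt (deformedForm a b a' b'))) ∧
    -- the Swanson model
    (∀ θ : ℝ,
      IsModel ((Real.cos θ : ℂ) • ladderC + (Complex.I * Real.sin θ) • ladderCdag)
        ((Real.cos θ : ℂ) • ladderCdag + (Complex.I * Real.sin θ) • ladderC) (swansonForm θ) ∧
      IsNilpotentN52 (CentralExt (swansonForm θ)) ∧
      IsUniquelyRealized (CentralExt (swansonForm θ))) ∧
    -- every Lie algebra with one-dimensional center equal to its derived algebra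
    -- and four-dimensional central quotient
    (∀ (𝔰 : Type*) [LieRing 𝔰] [LieAlgebra ℂ 𝔰] [FiniteDimensional ℂ 𝔰],
      (⁅(⊤ : LieIdeal ℂ 𝔰), (⊤ : LieIdeal ℂ 𝔰)⁆ : LieIdeal ℂ 𝔰) = LieAlgebra.center ℂ 𝔰 →
      Module.finrank ℂ (LieAlgebra.center ℂ 𝔰) = 1 →
      Module.finrank ℂ (𝔰 ⧸ LieAlgebra.center ℂ 𝔰) = 4 → IsUniquelyRealized 𝔰) := by
  refine ⟨fun n hn => ?_, fun α β _ => (model_shifted α β).1, (model_shifted 0 0).2, ?_,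
    fun a b c a' b' c' h => model_deformed c c' h, model_swanson, ?_⟩
  -- The witness is the Heisenberg algebra plus an abelian summand, which is abelian for n ≤ 2.
  · have hf := HeisenbergSum.hasFlagForm n
    have := hf.finiteDimensional
    have := hf.isNilpotent
    refine ⟨HeisenbergSum n, inferInstance, inferInstance, hf.finiteDimensional, hf.isNilpotent,
      hf.finrank_eq, hf.isUniquelyRealized hn (isRealizedStandard_of_heisenberg hn hf), ?_⟩
    intro 𝔤 _ _ _ _ hg
    exact ⟨deformsTo_of_finrank_le_five hn hg hf.finrank_eq,
      deformsTo_of_finrank_le_five hn hf.finrank_eq hg,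
      fun 𝔯' _ _ _ _ hr _ => deformsTo_of_finrank_le_five hn hg hr⟩
  · rintro 𝔟 _ _ ⟨f⟩
    obtain ⟨g⟩ := (model_shifted 0 0).2.2.2
    have hg := hasFlagForm_n52Form.of_equiv (f.trans g)
    exact hg.isUniquelyRealized le_rfl (isRealizedStandard_of_heisenberg le_rfl hg)
  · intro 𝔰 _ _ _ hd h1 h4
    exact isUniquelyRealized_of_center hd h1 h4
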